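/- Let $\Bbbk$ be a field (of any characteristic). Operads are symmetric operads over $\Bbbk$ with right $\mathbb S_n$-actions $*$, partial compositions $\circ_i:P(m)\otimes P(n)\to P(m+n-1)$ ($1\le i\le m$, $n\ge 0$) and identity $\mathbf 1\in P(1)$. For permutations $\phi\in\mathbb S_m$, $\sigma\in\mathbb S_n$, $\phi\circ_i\sigma\in\mathbb S_{m+n-1}$ denotes the permutation obtained by replacing the letter $i$ by a block of $n$ letters, permuting the block internally by $\sigma$, and permuting the remaining letters and the block as a whole by $\phi$; $1_m$ is the identity of $\mathbb S_m$. Let $\mathcal{A}s$ be the operad of unital associative algebras: $\mathcal{A}s(n)=\Bbbk\mathbb S_n$ for all $n\ge 0$, with the right regular action and the bilinearly extended compositions $\circ_i$ of permutations. For $I\subseteq\{1,\dots,n\}$ let $\pi^I(\theta)=\theta\circ(1_{\chi_I(1)},\dots,1_{\chi_I(n)})$ for $\theta\in\mathcal{A}s(n)$, where $\chi_I$ is the characteristic function of $I$ (so $1_0\in\mathcal{A}s(0)$ is inserted in the slots outside $I$). For $k\ge 1$ the $k$-th truncation ideal ${}^kI$ is given by ${}^kI(n)=\bigcap_{|I|=k-1}\ker\pi^I$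 if $n\ge k$, and ${}^kI(n)=0$ if $n<k$. For an operad $P$, a 2-cocycle is a pair $(\wp,\varsigma)$ of families of linear maps $\wp_i:P(m)\otimes P(n)\to P(m+n-1)$ ($1\le i\le m$, $n\ge 0$) and $\varsigma:P(m)\otimes\Bbbk\mathbb S_m\to P(m)$ ($m\ge 0$) such that, for $\lambda\in P(l)$, $\mu\in P(m)$, $\nu\in P(n)$, $\phi,\tau\in\mathbb S_m$ and $\sigma\in\mathbb S_n$, $$\wp_{i-1+j}(\lambda\circ_i\mu,\nu)+\wp_i(\lambda,\mu)\circ_{i-1+j}\nu=\wp_i(\lambda,\mu\circ_j\nu)+\lambda\circ_i\wp_j(\mu,\nu)\quad(1\le i\le l,\ 1\le j\le m),$$ $$\wp_{s-1+m}(\lambda\circ_i\mu,\nu)+\wp_i(\lambda,\mu)\circ_{s-1+m}\nu=\wp_i(\lambda\circ_s\nu,\mu)+\wp_s(\lambda,\nu)\circ_i\mu\quad(1\le i<s\le l),$$ $$\wp_i(\mu,\nu*\sigma)+\mu\circ_i\varsigma(\nu,\sigma)=\wp_i(\mu,\nu)*\sigma'+\varsigma(\mu\circ_i\nu,\sigma'),\qquad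 \sigma'=1_m\circ_i\sigma,$$ $$\wp_i(\mu*\phi,\nu)+\varsigma(\mu,\phi)\circ_i\nu=\wp_{\phi(i)}(\mu,\nu)*\phi''+\varsigma(\mu\circ_{\phi(i)}\nu,\phi''),\qquad \phi''=\phi\circ_i 1_n,$$ $$\varsigma(\mu,\phi\tau)=\varsigma(\mu*\phi,\tau)+\varsigma(\mu,\phi)*\tau .$$ It is a 2-coboundary if there is an arity-preserving linear map $\partial:P\to P$ with $\wp_i(\mu,\nu)=\partial(\mu\circ_i\nu)-\partial(\mu)\circ_i\nu-\mu\circ_i\partial(\nu)$ and $\varsigma(\mu,\sigma)=\partial(\mu*\sigma)-\partial(\mu)*\sigma$. Let $H^2_*(P)$ be the space of 2-cocycles modulo 2-coboundaries, and $H^2(P)$ the space of 2-cocycles with $\varsigma=0$ modulo 2-coboundaries with $\varsigma=0$. An infinitesimal deformation of $P$ is a $\Bbbk[\epsilon]$-linear operad structure ($\epsilon^2=0$) on $P[\epsilon]=P\otimes\Bbbk[\epsilon]$ with identity $\mathbf 1$, whose compositions and actions have the form $\mu\circ_i^\epsilon\nu=\mu\circ_i\nu+\wp_i(\mu,\nu)\epsilon$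 and $\mu*^\epsilon\sigma=\mu*\sigma+\varsigma(\mu,\sigma)\epsilon$ for $\mu,\nu\in P$, with $\Bbbk$-linear $\wp_i$ and $\varsigma$. It is trivial if there is a $\Bbbk[\epsilon]$-linear isomorphism of operads, of the form $\mu\mapsto\mu+\partial(\mu)\epsilon$ for $\mu\in P$ with $\partial:P\to P$ an arity-preserving $\Bbbk$-linear map, from it to the deformation with $\wp=0$ and $\varsigma=0$. **Theorem.** Let $k\ge 1$ be an integer with $k\ne 4$, and let $P=\mathcal{A}s/{}^kI$. Then $H^2(P)=0$ and $H^2_*(P)=0$, and every infinitesimal deformation of $P$ is trivial. -/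

import Mathlib

universe u v

open scoped TensorProduct DualNumber

/-! ## Partial composition of permutations -/

/-- The letters `0, …, k - 1` (`m + n = k + 1`) obtained from `0, …, m - 1` by replacing the letter
`i` with a block of `n` consecutive letters: `inl b` is the letter that comes from `b ≠ i`, and
`inr t` is the `t`-th letter of the inserted block. -/
def slotFun {m n k : ℕ} (h : m + n = k + 1) (i : Fin m) :
    {b : Fin m // b ≠ i} ⊕ Fin n → Fin k
  | Sum.inl b =>
      if hb : (b.1 : ℕ) < i then ⟨b.1, by omega⟩
      else ⟨b.1 + n - 1, by
        have h1 := b.1.isLt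
        have h2 : (b.1 : ℕ) ≠ i := fun e => b.2 (Fin.ext e)
        omega⟩
  | Sum.inr t => ⟨i + t, by omega⟩

theorem slotFun_inl_val {m n k : ℕ} (h : m + n = k + 1) (i : Fin m) (b : {b : Fin m // b ≠ i}) :
    (slotFun h i (Sum.inl b) : ℕ) = if (b.1 : ℕ) < i then (b.1 : ℕ) else b.1 + n - 1 := by
  simp only [slotFun]
  split_ifs <;> rfl

theorem slotFun_inr_val {m n k : ℕ} (h : m + n = k + 1) (i : Fin m) (t : Fin n) :
    (slotFun h i (Sum.inr t) : ℕ) = i + t := rfl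

theorem slotFun_bijective {m n k : ℕ} (h : m + n = k + 1) (i : Fin m) :
    Function.Bijective (slotFun h i) := by
  constructor
  · rintro (b | t) (b' | t') e
    · have e' := congrArg Fin.val e
      rw [slotFun_inl_val, slotFun_inl_val] at e'
      have h1 : (b.1 : ℕ) ≠ i := fun e => b.2 (Fin.ext e)
      have h2 : (b'.1 : ℕ) ≠ i := fun e => b'.2 (Fin.ext e)
      congr 1
      apply Subtype.ext
      apply Fin.ext
      split_ifs at e' <;> omega
    · exfalso
      have e' := congrArg Fin.val e
      rw [slotFun_inl_val, slotFun_inr_val] at e'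
      have h1 : (b.1 : ℕ) ≠ i := fun e => b.2 (Fin.ext e)
      have := t'.isLt
      split_ifs at e' <;> omega
    · exfalso
      have e' := congrArg Fin.val e
      rw [slotFun_inl_val, slotFun_inr_val] at e'
      have h1 : (b'.1 : ℕ) ≠ i := fun e => b'.2 (Fin.ext e)
      have := t.isLt
      split_ifs at e' <;> omega
    · have e' := congrArg Fin.val e
      rw [slotFun_inr_val, slotFun_inr_val] at e'
      congr 1
      apply Fin.ext
      omega
  · intro c
    have hi := i.isLt
    have hc := c.isLt
    by_cases h1 : (c : ℕ) < i
    · refine ⟨Sum.inl ⟨⟨c, by omega⟩, fun e => ?_⟩, Fin.ext ?_⟩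
      · have := congrArg Fin.val e
        simp only at this
        omega
      · rw [slotFun_inl_val]
        simp [h1]
    · by_cases h2 : (c : ℕ) < i + n
      · refine ⟨Sum.inr ⟨c - i, by omega⟩, Fin.ext ?_⟩
        rw [slotFun_inr_val]
        simp only
        omega
      · refine ⟨Sum.inl ⟨⟨c + 1 - n, by omega⟩, fun e => ?_⟩, Fin.ext ?_⟩
        · have := congrArg Fin.val e
          simp only at this
          omega
        · rw [slotFun_inl_val]
          simp only
          rw [if_neg (by omega)]
          omega

/-- `slotFun` as a bijection. -/
noncomputable def slotEquiv {m n k : ℕ} (h : m + n = k + 1) (i : Fin m) :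
    {b : Fin m // b ≠ i} ⊕ Fin n ≃ Fin k :=
  Equiv.ofBijective (slotFun h i) (slotFun_bijective h i)

/-- The partial composition `σ ∘_i τ ∈ S_{m+n-1}` of `σ ∈ S_m` and `τ ∈ S_n`: the letter `i` is
replaced by a block of `n` letters, `τ` permutes the letters of the block, and `σ` permutes the
remaining letters and the block as a whole (the block arrives at place `σ i`). -/
noncomputable def permComp {m n k : ℕ} (h : m + n = k + 1) (i : Fin m)
    (σ : Equiv.Perm (Fin m)) (τ : Equiv.Perm (Fin n)) : Equiv.Perm (Fin k) :=
  (slotEquiv h i).symm.trans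
    ((Equiv.sumCongr
      (σ.subtypeEquiv (p := fun b => b ≠ i) (q := fun b => b ≠ σ i)
        (fun _ => (not_congr σ.injective.eq_iff).symm)) τ).trans
      (slotEquiv h (σ i)))

theorem permComp_inl {m n k : ℕ} (h : m + n = k + 1) (i : Fin m)
    (σ : Equiv.Perm (Fin m)) (τ : Equiv.Perm (Fin n)) (b : {b : Fin m // b ≠ i}) :
    permComp h i σ τ (slotFun h i (Sum.inl b)) =
      slotFun h (σ i) (Sum.inl ⟨σ b.1, fun e => b.2 (σ.injective e)⟩) := by
  have : (slotEquiv h i).symm (slotFun h i (Sum.inl b)) = Sum.inl b :=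
    (slotEquiv h i).symm_apply_apply (Sum.inl b)
  simp only [permComp, Equiv.trans_apply, this]
  rfl

theorem permComp_inr {m n k : ℕ} (h : m + n = k + 1) (i : Fin m)
    (σ : Equiv.Perm (Fin m)) (τ : Equiv.Perm (Fin n)) (t : Fin n) :
    permComp h i σ τ (slotFun h i (Sum.inr t)) = slotFun h (σ i) (Sum.inr (τ t)) := by
  have : (slotEquiv h i).symm (slotFun h i (Sum.inr t)) = Sum.inr t :=
    (slotEquiv h i).symm_apply_apply (Sum.inr t)
  simp only [permComp, Equiv.trans_apply, this]
  rfl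

/-- A letter `b ≠ i` of the outer permutation keeps its image. -/
theorem permComp_val_outer {m n k : ℕ} (h : m + n = k + 1) (i : Fin m)
    (σ : Equiv.Perm (Fin m)) (τ : Equiv.Perm (Fin n)) (b : Fin m) (hb : b ≠ i) (c : Fin k)
    (hc : (c : ℕ) = if (b : ℕ) < i then (b : ℕ) else b + n - 1) :
    (permComp h i σ τ c : ℕ) =
      if (σ b : ℕ) < σ i then (σ b : ℕ) else σ b + n - 1 := by
  have : c = slotFun h i (Sum.inl ⟨b, hb⟩) := Fin.ext (by rw [hc, slotFun_inl_val])
  rw [this, permComp_inl, slotFun_inl_val]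

theorem permComp_val_inner {m n k : ℕ} (h : m + n = k + 1) (i : Fin m)
    (σ : Equiv.Perm (Fin m)) (τ : Equiv.Perm (Fin n)) (t : Fin n) (c : Fin k)
    (hc : (c : ℕ) = i + t) :
    (permComp h i σ τ c : ℕ) = σ i + τ t := by
  have : c = slotFun h i (Sum.inr t) := Fin.ext (by rw [hc, slotFun_inr_val])
  rw [this, permComp_inr, slotFun_inr_val]

theorem permComp_one_right {m : ℕ} (h : m + 1 = m + 1) (i : Fin m) (σ : Equiv.Perm (Fin m)) :
    permComp h i σ (1 : Equiv.Perm (Fin 1)) = σ := by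
  ext c
  by_cases hc : c = i
  · subst hc
    rw [permComp_val_inner h c σ 1 0 c (by simp)]
    simp
  · rw [permComp_val_outer h i σ 1 c hc c (by split_ifs <;> simp)]
    split_ifs <;> simp

theorem permComp_one_left {n : ℕ} (h : 1 + n = n + 1) (τ : Equiv.Perm (Fin n)) :
    permComp h 0 (1 : Equiv.Perm (Fin 1)) τ = τ := by
  ext c
  rw [permComp_val_inner h 0 1 τ c c (by simp)]
  simp

theorem permComp_mul {m n k : ℕ} (h : m + n = k + 1) (i : Fin m)
    (σ φ : Equiv.Perm (Fin m)) (τ ρ : Equiv.Perm (Fin n)) :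
    permComp h i (σ * φ) (τ * ρ) = permComp h (φ i) σ τ * permComp h i φ ρ := by
  ext c
  obtain ⟨x, rfl⟩ := (slotFun_bijective h i).2 c
  rw [Equiv.Perm.mul_apply]
  rcases x with b | t
  · rw [permComp_inl, permComp_inl, permComp_inl]
    rfl
  · rw [permComp_inr, permComp_inr, permComp_inr]
    rfl

theorem permComp_assoc {l m n p q r : ℕ} (hp : l + m = p + 1) (hr : p + n = r + 1)
    (hq : m + n = q + 1) (hr' : l + q = r + 1) (i : Fin l) (j : Fin m) (a : Fin p)
    (ha : (a : ℕ) = i + j) (σ : Equiv.Perm (Fin l)) (τ : Equiv.Perm (Fin m))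
    (ρ : Equiv.Perm (Fin n)) :
    permComp hr a (permComp hp i σ τ) ρ = permComp hr' i σ (permComp hq j τ ρ) := by
  have hpa : (permComp hp i σ τ a : ℕ) = σ i + τ j := permComp_val_inner hp i σ τ j a ha
  have hj := j.isLt
  have hτj := (τ j).isLt
  ext c
  obtain ⟨x, rfl⟩ := (slotFun_bijective hr' i).2 c
  rcases x with b | t
  · have hb : (b.1 : ℕ) ≠ i := fun e => b.2 (Fin.ext e)
    have hσ : (σ b.1 : ℕ) ≠ σ i := fun e => b.2 (σ.injective (Fin.ext e))
    rw [permComp_inl, slotFun_inl_val]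
    let d : Fin p := slotFun hp i (Sum.inl b)
    have hd : (d : ℕ) = _ := slotFun_inl_val hp i b
    have hpd : (permComp hp i σ τ d : ℕ) = _ := permComp_val_outer hp i σ τ b.1 b.2 d hd
    have hda : d ≠ a := by
      intro e
      have := congrArg Fin.val e
      rw [hd, ha] at this
      split_ifs at this <;> omega
    rw [permComp_val_outer hr a _ ρ d hda _ (by
      rw [slotFun_inl_val, hd, ha]
      split_ifs <;> omega), hpd, hpa]
    simp only
    split_ifs <;> omega
  · obtain ⟨y, rfl⟩ := (slotFun_bijective hq j).2 t
    rw [permComp_inr, slotFun_inr_val]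
    rcases y with b | s
    · have hb : (b.1 : ℕ) ≠ j := fun e => b.2 (Fin.ext e)
      have hτ : (τ b.1 : ℕ) ≠ τ j := fun e => b.2 (τ.injective (Fin.ext e))
      rw [permComp_inl, slotFun_inl_val]
      let d : Fin p := slotFun hp i (Sum.inr b.1)
      have hd : (d : ℕ) = _ := slotFun_inr_val hp i b.1
      have hpd : (permComp hp i σ τ d : ℕ) = _ := permComp_val_inner hp i σ τ b.1 d hd
      have hda : d ≠ a := by
        intro e
        have := congrArg Fin.val e
        rw [hd, ha] at this
        omega
      rw [permComp_val_outer hr a _ ρ d hda _ (by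
        rw [slotFun_inr_val, slotFun_inl_val, hd, ha]
        split_ifs <;> omega), hpd, hpa]
      simp only
      split_ifs <;> omega
    · rw [permComp_inr, slotFun_inr_val]
      rw [permComp_val_inner hr a _ ρ s _ (by
        rw [slotFun_inr_val, slotFun_inr_val, ha]; omega), hpa]
      omega

theorem permComp_comm {l m n p q r : ℕ} (hp : l + m = p + 1) (hr : p + n = r + 1)
    (hq : l + n = q + 1) (hr' : q + m = r + 1) (i k : Fin l) (hik : i < k) (a : Fin p)
    (ha : (a : ℕ) + 1 = k + m) (b : Fin q) (hb : (b : ℕ) = i) (σ : Equiv.Perm (Fin l))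
    (τ : Equiv.Perm (Fin m)) (ρ : Equiv.Perm (Fin n)) :
    permComp hr a (permComp hp i σ τ) ρ = permComp hr' b (permComp hq k σ ρ) τ := by
  have hik' : (i : ℕ) < k := hik
  have hne : (σ i : ℕ) ≠ σ k := fun e => (ne_of_lt hik) (σ.injective (Fin.ext e))
  have hpa : (permComp hp i σ τ a : ℕ) = _ :=
    permComp_val_outer hp i σ τ k (ne_of_gt hik) a (by rw [if_neg (by omega)]; omega)
  have hqb : (permComp hq k σ ρ b : ℕ) = _ :=
    permComp_val_outer hq k σ ρ i (ne_of_lt hik) b (by rw [if_pos (by omega)]; omega)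
  ext c
  obtain ⟨x, rfl⟩ := (slotFun_bijective hr a).2 c
  rcases x with d | s
  · obtain ⟨y, hy⟩ := (slotFun_bijective hp i).2 d.1
    have hda : (d.1 : ℕ) ≠ a := fun e => d.2 (Fin.ext e)
    rcases y with e | t
    · have hd := congrArg Fin.val hy
      rw [slotFun_inl_val] at hd
      have hei : (e.1 : ℕ) ≠ i := fun h => e.2 (Fin.ext h)
      have hek : e.1 ≠ k := by
        intro h
        rw [h] at hd
        rw [if_neg (by omega)] at hd
        omega
      have hek' : (e.1 : ℕ) ≠ k := fun h => hek (Fin.ext h)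
      have hσi : (σ e.1 : ℕ) ≠ σ i := fun h => e.2 (σ.injective (Fin.ext h))
      have hσk : (σ e.1 : ℕ) ≠ σ k := fun h => hek (σ.injective (Fin.ext h))
      have hpd : (permComp hp i σ τ d.1 : ℕ) = _ :=
        permComp_val_outer hp i σ τ e.1 e.2 d.1 hd.symm
      let f : Fin q := slotFun hq k (Sum.inl ⟨e.1, hek⟩)
      have hf : (f : ℕ) = _ := slotFun_inl_val hq k ⟨e.1, hek⟩
      simp only at hf
      have hqf : (permComp hq k σ ρ f : ℕ) = _ := permComp_val_outer hq k σ ρ e.1 hek f hf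
      have hfb : f ≠ b := by
        intro h
        have := congrArg Fin.val h
        rw [hf, hb] at this
        split_ifs at this <;> omega
      rw [permComp_inl, slotFun_inl_val]
      rw [permComp_val_outer hr' b _ τ f hfb _ (by
        rw [slotFun_inl_val, hf, hb, ← hd]
        split_ifs <;> omega), hqf, hqb]
      simp only [hpd, hpa]
      split_ifs <;> omega
    · have hd := congrArg Fin.val hy
      rw [slotFun_inr_val] at hd
      have ht := t.isLt
      have hτ := (τ t).isLt
      have hpd : (permComp hp i σ τ d.1 : ℕ) = _ :=
        permComp_val_inner hp i σ τ t d.1 hd.symm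
      rw [permComp_inl, slotFun_inl_val]
      rw [permComp_val_inner hr' b _ τ t _ (by
        rw [slotFun_inl_val, hb, ← hd]
        split_ifs <;> omega), hqb]
      simp only [hpd, hpa]
      split_ifs <;> omega
  · rw [permComp_inr, slotFun_inr_val]
    have hs := s.isLt
    have hρ := (ρ s).isLt
    let f : Fin q := slotFun hq k (Sum.inr s)
    have hf : (f : ℕ) = _ := slotFun_inr_val hq k s
    have hqf : (permComp hq k σ ρ f : ℕ) = _ := permComp_val_inner hq k σ ρ s f hf
    have hfb : f ≠ b := by
      intro h
      have := congrArg Fin.val h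
      rw [hf, hb] at this
      omega
    rw [permComp_val_outer hr' b _ τ f hfb _ (by
      rw [slotFun_inr_val, hf, hb]
      split_ifs <;> omega), hqf, hqb, hpa]
    split_ifs <;> omega

/-! ## Operads -/

/-- A symmetric operad structure over a commutative ring `R` on a sequence `(M n)_{n ≥ 0}` of
`R`-modules, in the partial-composition presentation.

* Slots and permuted letters are numbered from `0`: the classical `i`-th slot, `1 ≤ i ≤ m`, is
  the element `i - 1` of `Fin m`.
* The partial composition `∘_i : M m ⊗ M n → M (m + n - 1)` is given as a bilinear map into `M k`
  for the unique `k` with `m + n = k + 1` (note `m ≥ 1`, since `i : Fin m`).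
* `act σ x` is `x * σ`, the right action of `S_n` on `M n`. -/
structure OperadStructure (R : Type u) [CommRing R] (M : ℕ → Type v)
    [∀ n, AddCommGroup (M n)] [∀ n, Module R (M n)] where
  one : M 1
  act : ∀ {n : ℕ}, Equiv.Perm (Fin n) → (M n →ₗ[R] M n)
  comp : ∀ {m n k : ℕ}, m + n = k + 1 → Fin m → (M m →ₗ[R] M n →ₗ[R] M k)
  act_one : ∀ {n : ℕ} (x : M n), act 1 x = x
  act_mul : ∀ {n : ℕ} (σ τ : Equiv.Perm (Fin n)) (x : M n), act (σ * τ) x = act τ (act σ x)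
  comp_one : ∀ {m : ℕ} (h : m + 1 = m + 1) (i : Fin m) (x : M m), comp h i x one = x
  one_comp : ∀ {n : ℕ} (h : 1 + n = n + 1) (x : M n), comp h 0 one x = x
  comp_assoc : ∀ {l m n p q r : ℕ} (hp : l + m = p + 1) (hr : p + n = r + 1)
    (hq : m + n = q + 1) (hr' : l + q = r + 1) (i : Fin l) (j : Fin m) (a : Fin p),
    (a : ℕ) = i + j → ∀ (x : M l) (y : M m) (z : M n),
    comp hr a (comp hp i x y) z = comp hr' i x (comp hq j y z)
  comp_comm : ∀ {l m n p q r : ℕ} (hp : l + m = p + 1) (hr : p + n = r + 1)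
    (hq : l + n = q + 1) (hr' : q + m = r + 1) (i k : Fin l), i < k →
    ∀ (a : Fin p), (a : ℕ) + 1 = k + m → ∀ (b : Fin q), (b : ℕ) = i →
    ∀ (x : M l) (y : M m) (z : M n),
    comp hr a (comp hp i x y) z = comp hr' b (comp hq k x z) y
  comp_act_right : ∀ {m n k : ℕ} (h : m + n = k + 1) (i : Fin m) (x : M m) (y : M n)
    (σ : Equiv.Perm (Fin n)),
    comp h i x (act σ y) = act (permComp h i 1 σ) (comp h i x y)
  comp_act_left : ∀ {m n k : ℕ} (h : m + n = k + 1) (i : Fin m) (x : M m) (y : M n)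
    (φ : Equiv.Perm (Fin m)),
    comp h i (act φ x) y = act (permComp h i φ 1) (comp h (φ i) x y)

/-! ## The operad of unital associative algebras -/

/-- The right action of `S_n` on the group module `R[S_n]`, `x * σ`. -/
noncomputable def asAct (R : Type u) [CommRing R] {n : ℕ} (σ : Equiv.Perm (Fin n)) :
    (Equiv.Perm (Fin n) →₀ R) →ₗ[R] (Equiv.Perm (Fin n) →₀ R) :=
  Finsupp.lmapDomain R R (fun τ => τ * σ)

/-- The bilinear extension of the partial composition of permutations. -/
noncomputable def asComp (R : Type u) [CommRing R] {m n k : ℕ} (h : m + n = k + 1) (i : Fin m) :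
    (Equiv.Perm (Fin m) →₀ R) →ₗ[R] (Equiv.Perm (Fin n) →₀ R) →ₗ[R]
      (Equiv.Perm (Fin k) →₀ R) :=
  Finsupp.linearCombination R (fun σ => Finsupp.lmapDomain R R (fun τ => permComp h i σ τ))

theorem asAct_single (R : Type u) [CommRing R] {n : ℕ} (σ τ : Equiv.Perm (Fin n)) (c : R) :
    asAct R σ (Finsupp.single τ c) = Finsupp.single (τ * σ) c := by
  simp [asAct]

theorem asComp_single (R : Type u) [CommRing R] {m n k : ℕ} (h : m + n = k + 1) (i : Fin m)
    (σ : Equiv.Perm (Fin m)) (τ : Equiv.Perm (Fin n)) (c d : R) :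
    asComp R h i (Finsupp.single σ c) (Finsupp.single τ d) =
      Finsupp.single (permComp h i σ τ) (c * d) := by
  rw [asComp, Finsupp.linearCombination_single, LinearMap.smul_apply, Finsupp.lmapDomain_apply,
    Finsupp.mapDomain_single, Finsupp.smul_single, smul_eq_mul]

/-- The operad `As` encoding unital associative algebras: `As(n)` is the group module `R[S_n]`
(the free module on the elements of `S_n`) for every `n ≥ 0`, with the right regular action, and
the partial compositions extend those of permutations bilinearly. -/
noncomputable def asOperad (R : Type u) [CommRing R] :
    OperadStructure R (fun n => Equiv.Perm (Fin n) →₀ R) where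
  one := Finsupp.single 1 1
  act σ := asAct R σ
  comp h i := asComp R h i
  act_one x := by
    induction x using Finsupp.induction_linear with
    | zero => simp
    | add x y hx hy => rw [map_add, hx, hy]
    | single σ c => rw [asAct_single, mul_one]
  act_mul σ τ x := by
    induction x using Finsupp.induction_linear with
    | zero => simp
    | add x y hx hy => rw [map_add, hx, hy, ← map_add, ← map_add]
    | single σ c => simp only [asAct_single, mul_assoc]
  comp_one h i x := by
    induction x using Finsupp.induction_linear with
    | zero => simp
    | add x y hx hy => rw [map_add, LinearMap.add_apply, hx, hy]
    | single σ c => rw [asComp_single, permComp_one_right, mul_one]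
  one_comp h x := by
    induction x using Finsupp.induction_linear with
    | zero => simp
    | add x y hx hy => rw [map_add, hx, hy]
    | single σ c => rw [asComp_single, permComp_one_left, one_mul]
  comp_assoc hp hr hq hr' i j a ha x y z := by
    induction x using Finsupp.induction_linear with
    | zero => simp
    | add x x' hx hx' => simp only [map_add, LinearMap.add_apply, hx, hx']
    | single σ c =>
      induction y using Finsupp.induction_linear with
      | zero => simp
      | add y y' hy hy' => simp only [map_add, LinearMap.add_apply, hy, hy']
      | single τ d =>
        induction z using Finsupp.induction_linear with
        | zero => simp
        | add z z' hz hz' => simp only [map_add, hz, hz']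
        | single ρ e =>
          simp only [asComp_single, permComp_assoc hp hr hq hr' i j a ha, mul_assoc]
  comp_comm hp hr hq hr' i k hik a ha b hb x y z := by
    induction x using Finsupp.induction_linear with
    | zero => simp
    | add x x' hx hx' => simp only [map_add, LinearMap.add_apply, hx, hx']
    | single σ c =>
      induction y using Finsupp.induction_linear with
      | zero => simp
      | add y y' hy hy' => simp only [map_add, LinearMap.add_apply, hy, hy']
      | single τ d =>
        induction z using Finsupp.induction_linear with
        | zero => simp
        | add z z' hz hz' => simp only [map_add, LinearMap.add_apply, hz, hz']
        | single ρ e =>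
          simp only [asComp_single, permComp_comm hp hr hq hr' i k hik a ha b hb, mul_assoc,
            mul_comm d e]
  comp_act_right h i x y σ := by
    induction x using Finsupp.induction_linear with
    | zero => simp
    | add x x' hx hx' => simp only [map_add, LinearMap.add_apply, hx, hx']
    | single τ c =>
      induction y using Finsupp.induction_linear with
      | zero => simp
      | add y y' hy hy' => simp only [map_add, hy, hy']
      | single ρ d =>
        have := permComp_mul h i τ 1 ρ σ
        simp only [mul_one, Equiv.Perm.coe_one, id] at this
        simp only [asComp_single, asAct_single, this]
  comp_act_left h i x y φ := by
    induction x using Finsupp.induction_linear with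
    | zero => simp
    | add x x' hx hx' => simp only [map_add, LinearMap.add_apply, hx, hx']
    | single τ c =>
      induction y using Finsupp.induction_linear with
      | zero => simp
      | add y y' hy hy' => simp only [map_add, hy, hy']
      | single ρ d =>
        have := permComp_mul h i τ φ ρ 1
        simp only [mul_one] at this
        simp only [asComp_single, asAct_single, this]

/-! ## Ideals and quotients -/

section Quotient

variable {R : Type u} [CommRing R] {M : ℕ → Type v} [∀ n, AddCommGroup (M n)]
  [∀ n, Module R (M n)]

/-- An operadic ideal: a sequence of submodules that is stable under the symmetric groups and
absorbs partial compositions on both sides. -/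
structure OperadStructure.IsIdeal (O : OperadStructure R M) (I : ∀ n, Submodule R (M n)) :
    Prop where
  act_mem : ∀ {n : ℕ} (σ : Equiv.Perm (Fin n)) (x : M n), x ∈ I n → O.act σ x ∈ I n
  comp_mem_left : ∀ {m n k : ℕ} (h : m + n = k + 1) (i : Fin m) (x : M m) (y : M n),
    x ∈ I m → O.comp h i x y ∈ I k
  comp_mem_right : ∀ {m n k : ℕ} (h : m + n = k + 1) (i : Fin m) (x : M m) (y : M n),
    y ∈ I n → O.comp h i x y ∈ I k

/-- The partial composition induced on the quotients by an ideal: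
`[x] ∘_i [y] = [x ∘_i y]`. -/
def OperadStructure.quotientComp (O : OperadStructure R M) {I : ∀ n, Submodule R (M n)}
    (hI : O.IsIdeal I) {m n k : ℕ} (h : m + n = k + 1) (i : Fin m) :
    (M m ⧸ I m) →ₗ[R] (M n ⧸ I n) →ₗ[R] (M k ⧸ I k) :=
  (I m).liftQ
    ((I n).liftQ ((O.comp h i).compr₂ (I k).mkQ).flip (by
      intro y hy
      rw [LinearMap.mem_ker]
      ext x
      simpa using hI.comp_mem_right h i x y hy)).flip (by
    intro x hx
    rw [LinearMap.mem_ker]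
    ext y
    simpa using hI.comp_mem_left h i x y hx)

theorem OperadStructure.quotientComp_mk (O : OperadStructure R M)
    {I : ∀ n, Submodule R (M n)} (hI : O.IsIdeal I) {m n k : ℕ} (h : m + n = k + 1)
    (i : Fin m) (x : M m) (y : M n) :
    O.quotientComp hI h i (Submodule.Quotient.mk x) (Submodule.Quotient.mk y) =
      Submodule.Quotient.mk (O.comp h i x y) := rfl

/-- The quotient operad `P/I`, with `(P/I)(n) = P(n)/I(n)`. -/
def OperadStructure.quotient (O : OperadStructure R M) {I : ∀ n, Submodule R (M n)}
    (hI : O.IsIdeal I) : OperadStructure R (fun n => M n ⧸ I n) where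
  one := Submodule.Quotient.mk O.one
  act {n} σ := (I n).mapQ (I n) (O.act σ) (fun x hx => hI.act_mem σ x hx)
  comp h i := O.quotientComp hI h i
  act_one x := by
    obtain ⟨x, rfl⟩ := Submodule.Quotient.mk_surjective _ x
    simp [O.act_one]
  act_mul σ τ x := by
    obtain ⟨x, rfl⟩ := Submodule.Quotient.mk_surjective _ x
    simp [O.act_mul]
  comp_one h i x := by
    obtain ⟨x, rfl⟩ := Submodule.Quotient.mk_surjective _ x
    rw [O.quotientComp_mk, O.comp_one]
  one_comp h x := by
    obtain ⟨x, rfl⟩ := Submodule.Quotient.mk_surjective _ x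
    rw [O.quotientComp_mk, O.one_comp]
  comp_assoc hp hr hq hr' i j a ha x y z := by
    obtain ⟨x, rfl⟩ := Submodule.Quotient.mk_surjective _ x
    obtain ⟨y, rfl⟩ := Submodule.Quotient.mk_surjective _ y
    obtain ⟨z, rfl⟩ := Submodule.Quotient.mk_surjective _ z
    simp only [O.quotientComp_mk, O.comp_assoc hp hr hq hr' i j a ha]
  comp_comm hp hr hq hr' i k hik a ha b hb x y z := by
    obtain ⟨x, rfl⟩ := Submodule.Quotient.mk_surjective _ x
    obtain ⟨y, rfl⟩ := Submodule.Quotient.mk_surjective _ y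
    obtain ⟨z, rfl⟩ := Submodule.Quotient.mk_surjective _ z
    simp only [O.quotientComp_mk, O.comp_comm hp hr hq hr' i k hik a ha b hb]
  comp_act_right h i x y σ := by
    obtain ⟨x, rfl⟩ := Submodule.Quotient.mk_surjective _ x
    obtain ⟨y, rfl⟩ := Submodule.Quotient.mk_surjective _ y
    simp only [O.quotientComp_mk, Submodule.mapQ_apply, O.comp_act_right]
  comp_act_left h i x y φ := by
    obtain ⟨x, rfl⟩ := Submodule.Quotient.mk_surjective _ x
    obtain ⟨y, rfl⟩ := Submodule.Quotient.mk_surjective _ y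
    simp only [O.quotientComp_mk, Submodule.mapQ_apply, O.comp_act_left]

end Quotient

/-! ## Truncation ideals of a unitary operad -/

section Truncation

variable {R : Type u} [CommRing R] {M : ℕ → Type v} [∀ n, AddCommGroup (M n)]
  [∀ n, Module R (M n)]

/-- The arity reached from arity `m` by filling the slots `j - 1, …, 0` with elements of arities
`a (j - 1), …, a 0`. -/
def fillArity (a : ℕ → ℕ) : ℕ → ℕ → ℕ
  | 0, m => m
  | j + 1, m => fillArity a j (m + a j - 1)

/-- Fills the slots `j - 1, …, 0` of an operation of arity `m ≥ j` with `ν (j - 1), …, ν 0`,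
starting with the last one, so that the numbers of the slots still to be filled do not change. -/
def OperadStructure.fillSlots (O : OperadStructure R M) (a : ℕ → ℕ) (ν : ∀ i, M (a i)) :
    ∀ (j m : ℕ), j ≤ m → (M m →ₗ[R] M (fillArity a j m))
  | 0, _, _ => LinearMap.id
  | j + 1, m, hj =>
      (O.fillSlots a ν j (m + a j - 1) (by omega)).comp
        ((O.comp (k := m + a j - 1) (by omega) ⟨j, by omega⟩).flip (ν j))

/-- The total composition `θ ↦ θ ∘ (ν 0, …, ν (n - 1))` on operations `θ` of arity `n`. -/
def OperadStructure.totalComp (O : OperadStructure R M) (a : ℕ → ℕ) (ν : ∀ i, M (a i)) (n : ℕ) :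
    M n →ₗ[R] M (fillArity a n n) :=
  O.fillSlots a ν n n le_rfl

/-- `1_χ` for `χ ∈ {0, 1}`: the identity `1_1 = 1` and the `0`-unit `1_0 = u`. -/
def OperadStructure.unitElt (O : OperadStructure R M) (u : M 0) : ∀ b : Bool, M b.toNat
  | true => O.one
  | false => u

/-- The restriction operator `π^I(θ) = θ ∘ (1_{χ_I(0)}, …, 1_{χ_I(n-1)})` on operations of arity
`n`, for a set `I ⊆ {0, …, n - 1}` with characteristic function `χ_I`. -/
def OperadStructure.restriction (O : OperadStructure R M) (u : M 0) (I : Finset ℕ) (n : ℕ) :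
    M n →ₗ[R] M (fillArity (fun i => (decide (i ∈ I)).toNat) n n) :=
  O.totalComp (fun i => (decide (i ∈ I)).toNat) (fun i => O.unitElt u (decide (i ∈ I))) n

/-- The `k`-th truncation ideal: for `k ≥ 1`, it is the intersection of the kernels of the
restriction operators `π^I`, `|I| = k - 1`, in arities `n ≥ k`, and `0` in arities `n < k`; for
`k = 0` it is everything. -/
def OperadStructure.truncIdeal (O : OperadStructure R M) (u : M 0) (k n : ℕ) :
    Submodule R (M n) :=
  if k = 0 then ⊤
  else if n < k then ⊥
  else ⨅ I ∈ (Finset.range n).powersetCard (k - 1), LinearMap.ker (O.restriction u I n)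

/-! The truncation ideals are ideals. -/

/-- The family `1_χ` for a sequence of bits `χ`. -/
abbrev OperadStructure.fillBits (O : OperadStructure R M) (u : M 0) (χ : ℕ → Bool) (j m : ℕ)
    (h : j ≤ m) : M m →ₗ[R] M (fillArity (fun i => (χ i).toNat) j m) :=
  O.fillSlots (fun i => (χ i).toNat) (fun i => O.unitElt u (χ i)) j m h

theorem OperadStructure.fillBits_succ (O : OperadStructure R M) (u : M 0) (χ : ℕ → Bool)
    (j m m' : ℕ) (h : j + 1 ≤ m) (b : Bool) (hb : χ j = b) (hm : m + b.toNat = m' + 1) (x : M m) :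
    O.fillBits u χ (j + 1) m h x = 0 ↔
      O.fillBits u χ j m' (by omega) (O.comp hm ⟨j, by omega⟩ x (O.unitElt u b)) = 0 := by
  subst hb
  obtain rfl : m' = m + (χ j).toNat - 1 := by omega
  exact Iff.rfl

theorem OperadStructure.fillBits_congr (O : OperadStructure R M) (u : M 0) (χ χ' : ℕ → Bool)
    (j : ℕ) (hχ : ∀ i < j, χ i = χ' i) (m : ℕ) (h : j ≤ m) (x : M m) :
    O.fillBits u χ j m h x = 0 ↔ O.fillBits u χ' j m h x = 0 := by
  induction j generalizing m with
  | zero => exact Iff.rfl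
  | succ j ih =>
    have hm : m + (χ j).toNat = (m + (χ j).toNat - 1) + 1 := by omega
    rw [O.fillBits_succ u χ j m _ h (χ j) rfl hm,
      O.fillBits_succ u χ' j m _ h (χ j) (hχ j (by omega)).symm hm]
    exact ih (fun i hi => hχ i (by omega)) _ _ _

theorem OperadStructure.fillBits_true (O : OperadStructure R M) (u : M 0) (χ : ℕ → Bool)
    (j : ℕ) (hχ : ∀ i < j, χ i = true) (m : ℕ) (h : j ≤ m) (x : M m) :
    O.fillBits u χ j m h x = 0 ↔ x = 0 := by
  induction j with
  | zero => exact Iff.rfl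
  | succ j ih =>
    rw [O.fillBits_succ u χ j m m h true (hχ j (by omega)) rfl]
    have e : O.comp (m := m) (n := 1) (k := m) rfl ⟨j, by omega⟩ x (O.unitElt u true) = x :=
      O.comp_one rfl ⟨j, by omega⟩ x
    rw [show O.comp (m := m) (n := true.toNat) (k := m) rfl ⟨j, by omega⟩ x (O.unitElt u true) = x
      from e]
    exact ih (fun i hi => hχ i (by omega)) _

/-- Removing a `0` from the bits amounts to composing with the `0`-unit first. -/
theorem OperadStructure.fillBits_skip (O : OperadStructure R M) (u : M 0) (N : ℕ) :
    ∀ (j : ℕ) (_ : j ≤ N) (χ χ' : ℕ → Bool) (_ : χ j = false) (_ : ∀ i < j, χ' i = χ i)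
      (_ : ∀ i, j ≤ i → χ' i = χ (i + 1)) (m m' : ℕ) (hm : m + 0 = m' + 1) (hN : N + 1 ≤ m)
      (x : M m),
      O.fillBits u χ (N + 1) m hN x = 0 ↔
        O.fillBits u χ' N m' (by omega) (O.comp hm ⟨j, by omega⟩ x u) = 0 := by
  induction N with
  | zero =>
    intro j hj χ χ' h0 h1 h2 m m' hm hN x
    obtain rfl : j = 0 := by omega
    rw [O.fillBits_succ u χ 0 m m' hN false h0 hm]
    exact Iff.rfl
  | succ N ih =>
    intro j hj χ χ' h0 h1 h2 m m' hm hN x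
    rcases Nat.lt_or_ge j (N + 1) with hlt | hge
    · have hb : χ' N = χ (N + 1) := h2 N (by omega)
      have hm1 : m + (χ (N + 1)).toNat = (m + (χ (N + 1)).toNat - 1) + 1 := by omega
      have hm2 : m' + (χ (N + 1)).toNat = (m' + (χ (N + 1)).toNat - 1) + 1 := by omega
      have hm3 : (m + (χ (N + 1)).toNat - 1) + 0 = (m' + (χ (N + 1)).toNat - 1) + 1 := by omega
      rw [O.fillBits_succ u χ (N + 1) m _ hN (χ (N + 1)) rfl hm1,
        O.fillBits_succ u χ' N m' _ (by omega) (χ (N + 1)) hb hm2,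
        ih j (by omega) χ χ' h0 h1 h2 _ _ hm3 (by omega)]
      rw [O.comp_comm hm hm2 hm1 hm3 ⟨j, by omega⟩ ⟨N + 1, by omega⟩ (by
          rw [Fin.lt_def]; exact hlt) ⟨N, by omega⟩ rfl ⟨j, by omega⟩ rfl]
    · obtain rfl : j = N + 1 := by omega
      rw [O.fillBits_succ u χ (N + 1) m m' hN false h0 hm]
      exact O.fillBits_congr u χ χ' (N + 1) (fun i hi => (h1 i hi).symm) _ _ _

/-- All restrictions to `s` inputs vanish. -/
def OperadStructure.Vanish (O : OperadStructure R M) (u : M 0) (s n : ℕ) (x : M n) : Prop :=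
  ∀ I ∈ (Finset.range n).powersetCard s, O.restriction u I n x = 0

theorem OperadStructure.vanish_self (O : OperadStructure R M) (u : M 0) (n : ℕ) (x : M n) :
    O.Vanish u n n x ↔ x = 0 := by
  have : (Finset.range n).powersetCard n = {Finset.range n} := by
    conv_lhs => rw [show n = (Finset.range n).card from (Finset.card_range n).symm]
    rw [Finset.card_range]
    exact (by simpa using Finset.powersetCard_self (Finset.range n))
  simp only [OperadStructure.Vanish, this, Finset.mem_singleton, forall_eq]
  exact O.fillBits_true u (fun i => decide (i ∈ Finset.range n)) n
    (fun i hi => by simpa using hi) n le_rfl x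

theorem OperadStructure.vanish_succ (O : OperadStructure R M) (u : M 0) (s n : ℕ) (hs : s ≤ n)
    (x : M (n + 1)) :
    O.Vanish u s (n + 1) x ↔
      ∀ j : Fin (n + 1), O.Vanish u s n (O.comp (m := n + 1) (n := 0) (k := n) rfl j x u) := by
  constructor
  · intro hx j I hI
    rw [Finset.mem_powersetCard] at hI
    let f : ℕ → ℕ := fun i => if i < (j : ℕ) then i else i + 1
    have hf : Function.Injective f := by
      intro a b hab
      simp only [f] at hab
      split_ifs at hab <;> omega
    have hJ : I.image f ∈ (Finset.range (n + 1)).powersetCard s := by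
      rw [Finset.mem_powersetCard, Finset.card_image_of_injective _ hf]
      refine ⟨fun a ha => ?_, hI.2⟩
      obtain ⟨i, hi, rfl⟩ := Finset.mem_image.1 ha
      have := Finset.mem_range.1 (hI.1 hi)
      simp only [f, Finset.mem_range]
      split_ifs <;> omega
    refine (O.fillBits_skip u n j (by omega) (fun i => decide (i ∈ I.image f))
      (fun i => decide (i ∈ I)) ?_ ?_ ?_ (n + 1) n rfl le_rfl x).1 (hx _ hJ)
    · simp only [decide_eq_false_iff_not, Finset.mem_image, not_exists, not_and, f]
      intro i _ h
      split_ifs at h <;> omega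
    · intro i hi
      have : f i = i := if_pos hi
      simp only [decide_eq_decide]
      conv_rhs => rw [← this]
      rw [hf.mem_finset_image]
    · intro i hi
      have : f i = i + 1 := if_neg (by omega)
      simp only [decide_eq_decide]
      rw [← this, hf.mem_finset_image]
  · intro hx I hI
    rw [Finset.mem_powersetCard] at hI
    obtain ⟨j, hj, hjI⟩ : ∃ j ∈ Finset.range (n + 1), j ∉ I := by
      by_contra hcon
      push Not at hcon
      have := Finset.card_le_card (show Finset.range (n + 1) ⊆ I from hcon)
      rw [Finset.card_range, hI.2] at this
      omega
    have hj' := Finset.mem_range.1 hj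
    let f : ℕ → ℕ := fun i => if i < j then i else i + 1
    have hf : Function.Injective f := by
      intro a b hab
      simp only [f] at hab
      split_ifs at hab <;> omega
    let J : Finset ℕ := (Finset.range n).filter (fun i => f i ∈ I)
    have hJI : J.image f = I := by
      ext a
      simp only [J, Finset.mem_image, Finset.mem_filter, Finset.mem_range]
      constructor
      · rintro ⟨i, ⟨_, hi⟩, rfl⟩
        exact hi
      · intro ha
        have h1 := Finset.mem_range.1 (hI.1 ha)
        have h2 : a ≠ j := fun e => hjI (e ▸ ha)
        rcases Nat.lt_or_ge a j with h | h
        · have : f a = a := if_pos h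
          exact ⟨a, ⟨by omega, by rwa [this]⟩, this⟩
        · have : f (a - 1) = a := by
            simp only [f]
            rw [if_neg (by omega)]
            omega
          exact ⟨a - 1, ⟨by omega, by rwa [this]⟩, this⟩
    have hJ : J ∈ (Finset.range n).powersetCard s := by
      rw [Finset.mem_powersetCard]
      refine ⟨Finset.filter_subset _ _, ?_⟩
      rw [← hI.2, ← hJI, Finset.card_image_of_injective _ hf]
    have hmem : ∀ i, f i ∈ I ↔ i ∈ J := by
      intro i
      rw [← hJI, hf.mem_finset_image]
    refine (O.fillBits_skip u n j (by omega) (fun i => decide (i ∈ I))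
      (fun i => decide (i ∈ J)) (by simpa using hjI) ?_ ?_ (n + 1) n rfl le_rfl x).2
      (hx ⟨j, hj'⟩ J hJ)
    · intro i hi
      have : f i = i := if_pos hi
      simp only [decide_eq_decide]
      rw [← hmem i, this]
    · intro i hi
      have : f i = i + 1 := if_neg (by omega)
      simp only [decide_eq_decide]
      rw [← hmem i, this]

theorem OperadStructure.mem_truncIdeal_of_lt (O : OperadStructure R M) (u : M 0) {k n : ℕ}
    (hn : n < k) (x : M n) : x ∈ O.truncIdeal u k n ↔ x = 0 := by
  rw [OperadStructure.truncIdeal, if_neg (by omega), if_pos hn, Submodule.mem_bot]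

theorem OperadStructure.mem_truncIdeal_iff_vanish (O : OperadStructure R M) (u : M 0) {k n : ℕ}
    (hk : 1 ≤ k) (hn : k - 1 ≤ n) (x : M n) :
    x ∈ O.truncIdeal u k n ↔ O.Vanish u (k - 1) n x := by
  rcases Nat.lt_or_ge n k with h | h
  · obtain rfl : n = k - 1 := by omega
    rw [O.mem_truncIdeal_of_lt u h, O.vanish_self]
  · rw [OperadStructure.truncIdeal, if_neg (by omega), if_neg (by omega)]
    simp only [Submodule.mem_iInf, LinearMap.mem_ker]
    exact Iff.rfl

/-- In arities `n + 1 ≥ k ≥ 1`, an element lies in the `k`-th truncation ideal if and only if all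
its partial compositions with the `0`-unit do. -/
theorem OperadStructure.mem_truncIdeal_succ (O : OperadStructure R M) (u : M 0) {k n : ℕ}
    (hk : 1 ≤ k) (hn : k ≤ n + 1) (x : M (n + 1)) :
    x ∈ O.truncIdeal u k (n + 1) ↔
      ∀ j : Fin (n + 1), O.comp (m := n + 1) (n := 0) (k := n) rfl j x u ∈ O.truncIdeal u k n := by
  rw [O.mem_truncIdeal_iff_vanish u hk (by omega), O.vanish_succ u _ _ (by omega)]
  exact forall_congr' fun j => (O.mem_truncIdeal_iff_vanish u hk (by omega) _).symm

theorem OperadStructure.comp_unit_mem_truncIdeal (O : OperadStructure R M) (u : M 0) {k m n : ℕ}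
    (h : m + 0 = n + 1) (j : Fin m) (x : M m) (hx : x ∈ O.truncIdeal u k m) :
    O.comp h j x u ∈ O.truncIdeal u k n := by
  obtain rfl : m = n + 1 := by omega
  rcases Nat.eq_zero_or_pos k with rfl | hk
  · simp [OperadStructure.truncIdeal]
  rcases Nat.lt_or_ge (n + 1) k with h1 | h1
  · rw [O.mem_truncIdeal_of_lt u h1] at hx
    rw [hx, map_zero, LinearMap.zero_apply]
    exact zero_mem _
  · exact (O.mem_truncIdeal_succ u hk h1 x).1 hx j

/-- The truncation ideals of a unitary operad (that is, `P(0)` is spanned by `u`) are ideals. -/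
theorem OperadStructure.truncIdeal_isIdeal (O : OperadStructure R M) (u : M 0)
    (hu : ∀ x : M 0, ∃ c : R, x = c • u) (k : ℕ) : O.IsIdeal (O.truncIdeal u k) := by
  rcases Nat.eq_zero_or_pos k with rfl | hk
  · constructor <;> intros <;> simp [OperadStructure.truncIdeal]
  constructor
  · intro n
    induction n with
    | zero =>
      intro σ x hx
      obtain rfl : σ = 1 := Subsingleton.elim _ _
      rwa [O.act_one]
    | succ n ih =>
      intro σ x hx
      rcases Nat.lt_or_ge (n + 1) k with h | h
      · rw [O.mem_truncIdeal_of_lt u h] at hx ⊢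
        rw [hx, map_zero]
      · rw [O.mem_truncIdeal_succ u hk h]
        intro j
        rw [O.comp_act_left]
        exact ih _ _ (O.comp_unit_mem_truncIdeal u rfl _ x hx)
  · intro m n r h i x y hx
    induction r generalizing m n with
    | zero =>
      rcases Nat.lt_or_ge m k with h1 | h1
      · rw [O.mem_truncIdeal_of_lt u h1] at hx
        rw [hx, map_zero, LinearMap.zero_apply]
        exact zero_mem _
      · have hi := i.isLt
        obtain rfl : n = 0 := by omega
        obtain ⟨c, rfl⟩ := hu y
        rw [map_smul]
        exact Submodule.smul_mem _ _ (O.comp_unit_mem_truncIdeal u h i x hx)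
    | succ r ih =>
      rcases Nat.lt_or_ge m k with h1 | h1
      · rw [O.mem_truncIdeal_of_lt u h1] at hx
        rw [hx, map_zero, LinearMap.zero_apply]
        exact zero_mem _
      · rcases Nat.eq_zero_or_pos n with rfl | hn
        · obtain ⟨c, rfl⟩ := hu y
          rw [map_smul]
          exact Submodule.smul_mem _ _ (O.comp_unit_mem_truncIdeal u h i x hx)
        · rw [O.mem_truncIdeal_succ u hk (by omega)]
          intro a
          have hi := i.isLt
          have ha := a.isLt
          rcases Nat.lt_or_ge (a : ℕ) i with h2 | h2
          · rw [← O.comp_comm (p := m - 1) (l := m) (m := 0) (n := n) (q := r + 1) (r := r) (by omega)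
              (by omega) h rfl ⟨a, by omega⟩ i
              (by rw [Fin.lt_def]; exact h2) ⟨i - 1, by omega⟩ (by simp only; omega) a rfl]
            exact ih _ _ _ _ (O.comp_unit_mem_truncIdeal u _ _ x hx)
          · rcases Nat.lt_or_ge (a : ℕ) (i + n) with h3 | h3
            · rw [O.comp_assoc (n := 0) (r := r) h rfl (q := n - 1) (by omega) (by omega) i ⟨a - i, by omega⟩ a
                (by simp only; omega)]
              exact ih _ _ _ _ hx
            · rw [O.comp_comm (n := 0) (r := r) h rfl (q := m - 1) (by omega) (by omega) i ⟨a + 1 - n, by omega⟩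
                (by rw [Fin.lt_def]; simp only; omega) a (by simp only; omega) ⟨i, by omega⟩ rfl]
              exact ih _ _ _ _ (O.comp_unit_mem_truncIdeal u _ _ x hx)
  · intro m n r h i x y hy
    induction r generalizing m n with
    | zero =>
      rcases Nat.lt_or_ge n k with h1 | h1
      · rw [O.mem_truncIdeal_of_lt u h1] at hy
        rw [hy, map_zero]
        exact zero_mem _
      · have hi := i.isLt
        obtain rfl : m = 1 := by omega
        obtain rfl : n = 0 := by omega
        omega
    | succ r ih =>
      rcases Nat.lt_or_ge n k with h1 | h1
      · rw [O.mem_truncIdeal_of_lt u h1] at hy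
        rw [hy, map_zero]
        exact zero_mem _
      · have hi := i.isLt
        rw [O.mem_truncIdeal_succ u hk (by omega)]
        intro a
        have ha := a.isLt
        rcases Nat.lt_or_ge (a : ℕ) i with h2 | h2
        · rw [← O.comp_comm (p := m - 1) (l := m) (m := 0) (n := n) (q := r + 1) (r := r) (by omega)
              (by omega) h rfl ⟨a, by omega⟩ i
            (by rw [Fin.lt_def]; exact h2) ⟨i - 1, by omega⟩ (by simp only; omega) a rfl]
          exact ih _ _ _ _ hy
        · rcases Nat.lt_or_ge (a : ℕ) (i + n) with h3 | h3
          · rw [O.comp_assoc (n := 0) (r := r) h rfl (q := n - 1) (by omega) (by omega) i ⟨a - i, by omega⟩ a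
              (by simp only; omega)]
            exact ih _ _ _ _ (O.comp_unit_mem_truncIdeal u _ _ y hy)
          · rw [O.comp_comm (n := 0) (r := r) h rfl (q := m - 1) (by omega) (by omega) i ⟨a + 1 - n, by omega⟩
              (by rw [Fin.lt_def]; simp only; omega) a (by simp only; omega) ⟨i, by omega⟩ rfl]
            exact ih _ _ _ _ hy

end Truncation

/-- The `0`-unit `1_0 ∈ S_0` of `As`. -/
noncomputable def asUnit (R : Type u) [CommRing R] : Equiv.Perm (Fin 0) →₀ R :=
  Finsupp.single 1 1

theorem asUnit_spans (R : Type u) [CommRing R] (x : Equiv.Perm (Fin 0) →₀ R) :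
    ∃ c : R, x = c • asUnit R := by
  refine ⟨x 1, Finsupp.ext fun σ => ?_⟩
  obtain rfl : σ = 1 := Subsingleton.elim _ _
  simp [asUnit]

/-- The underlying modules of the truncation `As/ᵏI`. -/
abbrev AsTruncModule (R : Type u) [CommRing R] (k n : ℕ) : Type u :=
  (Equiv.Perm (Fin n) →₀ R) ⧸ (asOperad R).truncIdeal (asUnit R) k n

/-- The truncation `As/ᵏI` of the operad `As` by its `k`-th truncation ideal. -/
noncomputable def asTrunc (R : Type u) [CommRing R] (k : ℕ) :
    OperadStructure R (AsTruncModule R k) :=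
  (asOperad R).quotient ((asOperad R).truncIdeal_isIdeal (asUnit R) (asUnit_spans R) k)

/-! ## Second cohomology -/

/-- The index set of the partial compositions: arities `m`, `n`, `k` with `m + n = k + 1`, and a
slot `i` of the first operation. -/
structure CompIndex where
  m : ℕ
  n : ℕ
  k : ℕ
  arity : m + n = k + 1
  i : Fin m

section Cohomology

variable {R : Type u} [CommRing R] {M : ℕ → Type v} [∀ n, AddCommGroup (M n)]
  [∀ n, Module R (M n)]

/-- The module of `℘ς`-collections: bilinear maps `℘_i : M m ⊗ M n → M (m + n - 1)`, one for each
partial composition, together with linear maps `ς_m : M m ⊗ R[S_m] → M m`; since `S_m` is a basis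
of `R[S_m]`, the latter are given as families of linear maps `x ↦ ς(x, σ)` indexed by `σ ∈ S_m`. -/
def WVCollection (R : Type u) [CommRing R] (M : ℕ → Type v) [∀ n, AddCommGroup (M n)]
    [∀ n, Module R (M n)] : Type v :=
  (∀ c : CompIndex, M c.m →ₗ[R] M c.n →ₗ[R] M c.k) ×
    (∀ m : ℕ, Equiv.Perm (Fin m) → (M m →ₗ[R] M m))

noncomputable instance : AddCommGroup (WVCollection R M) :=
  inferInstanceAs (AddCommGroup ((∀ c : CompIndex, M c.m →ₗ[R] M c.n →ₗ[R] M c.k) ×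
    (∀ m : ℕ, Equiv.Perm (Fin m) → (M m →ₗ[R] M m))))

noncomputable instance : Module R (WVCollection R M) :=
  inferInstanceAs (Module R ((∀ c : CompIndex, M c.m →ₗ[R] M c.n →ₗ[R] M c.k) ×
    (∀ m : ℕ, Equiv.Perm (Fin m) → (M m →ₗ[R] M m))))

/-- `w.wp h i x y` is `℘_i(x, y)`. -/
def WVCollection.wp (w : WVCollection R M) {m n k : ℕ} (h : m + n = k + 1) (i : Fin m) :
    M m →ₗ[R] M n →ₗ[R] M k :=
  w.1 ⟨m, n, k, h, i⟩

/-- `w.vs σ x` is `ς(x, σ)`. -/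
def WVCollection.vs (w : WVCollection R M) {m : ℕ} (σ : Equiv.Perm (Fin m)) : M m →ₗ[R] M m :=
  w.2 m σ

/-- The 2-cocycle conditions on a `℘ς`-collection. -/
structure OperadStructure.IsTwoCocycle (O : OperadStructure R M) (w : WVCollection R M) :
    Prop where
  assoc : ∀ {l m n p q r : ℕ} (hp : l + m = p + 1) (hr : p + n = r + 1)
    (hq : m + n = q + 1) (hr' : l + q = r + 1) (i : Fin l) (j : Fin m) (a : Fin p),
    (a : ℕ) = i + j → ∀ (x : M l) (y : M m) (z : M n),
    w.wp hr a (O.comp hp i x y) z + O.comp hr a (w.wp hp i x y) z =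
      w.wp hr' i x (O.comp hq j y z) + O.comp hr' i x (w.wp hq j y z)
  comm : ∀ {l m n p q r : ℕ} (hp : l + m = p + 1) (hr : p + n = r + 1)
    (hq : l + n = q + 1) (hr' : q + m = r + 1) (i k : Fin l), i < k →
    ∀ (a : Fin p), (a : ℕ) + 1 = k + m → ∀ (b : Fin q), (b : ℕ) = i →
    ∀ (x : M l) (y : M m) (z : M n),
    w.wp hr a (O.comp hp i x y) z + O.comp hr a (w.wp hp i x y) z =
      w.wp hr' b (O.comp hq k x z) y + O.comp hr' b (w.wp hq k x z) y
  act_right : ∀ {m n k : ℕ} (h : m + n = k + 1) (i : Fin m) (x : M m) (y : M n)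
    (σ : Equiv.Perm (Fin n)),
    w.wp h i x (O.act σ y) + O.comp h i x (w.vs σ y) =
      O.act (permComp h i 1 σ) (w.wp h i x y) + w.vs (permComp h i 1 σ) (O.comp h i x y)
  act_left : ∀ {m n k : ℕ} (h : m + n = k + 1) (i : Fin m) (x : M m) (y : M n)
    (φ : Equiv.Perm (Fin m)),
    w.wp h i (O.act φ x) y + O.comp h i (w.vs φ x) y =
      O.act (permComp h i φ 1) (w.wp h (φ i) x y) +
        w.vs (permComp h i φ 1) (O.comp h (φ i) x y)
  act_mul : ∀ {m : ℕ} (x : M m) (σ τ : Equiv.Perm (Fin m)),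
    w.vs (σ * τ) x = w.vs τ (O.act σ x) + O.act τ (w.vs σ x)

theorem WVCollection.wp_add (w w' : WVCollection R M) {m n k : ℕ} (h : m + n = k + 1)
    (i : Fin m) (x : M m) (y : M n) :
    WVCollection.wp (w + w') h i x y = w.wp h i x y + w'.wp h i x y := rfl

theorem WVCollection.vs_add (w w' : WVCollection R M) {m : ℕ} (σ : Equiv.Perm (Fin m))
    (x : M m) : WVCollection.vs (w + w') σ x = w.vs σ x + w'.vs σ x := rfl

theorem WVCollection.wp_smul (c : R) (w : WVCollection R M) {m n k : ℕ} (h : m + n = k + 1)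
    (i : Fin m) (x : M m) (y : M n) :
    WVCollection.wp (c • w) h i x y = c • w.wp h i x y := rfl

theorem WVCollection.vs_smul (c : R) (w : WVCollection R M) {m : ℕ} (σ : Equiv.Perm (Fin m))
    (x : M m) : WVCollection.vs (c • w) σ x = c • w.vs σ x := rfl

theorem WVCollection.wp_zero {m n k : ℕ} (h : m + n = k + 1) (i : Fin m) (x : M m) (y : M n) :
    WVCollection.wp (0 : WVCollection R M) h i x y = 0 := rfl

theorem WVCollection.vs_zero {m : ℕ} (σ : Equiv.Perm (Fin m)) (x : M m) :
    WVCollection.vs (0 : WVCollection R M) σ x = 0 := rfl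

/-- The module `Z²_*(P)` of 2-cocycles. -/
noncomputable def OperadStructure.Z2Star (O : OperadStructure R M) : Submodule R (WVCollection R M) where
  carrier := {w | O.IsTwoCocycle w}
  zero_mem' := by
    constructor <;> intros <;> simp [WVCollection.wp_zero, WVCollection.vs_zero]
  add_mem' {w w'} hw hw' := by
    constructor
    · intro l m n p q r hp hr hq hr' i j a ha x y z
      have h1 := hw.assoc hp hr hq hr' i j a ha x y z
      have h2 := hw'.assoc hp hr hq hr' i j a ha x y z
      simp only [WVCollection.wp_add, map_add, LinearMap.add_apply]
      rw [add_add_add_comm, h1, h2, add_add_add_comm]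
    · intro l m n p q r hp hr hq hr' i k hik a ha b hb x y z
      have h1 := hw.comm hp hr hq hr' i k hik a ha b hb x y z
      have h2 := hw'.comm hp hr hq hr' i k hik a ha b hb x y z
      simp only [WVCollection.wp_add, map_add, LinearMap.add_apply]
      rw [add_add_add_comm, h1, h2, add_add_add_comm]
    · intro m n k h i x y σ
      have h1 := hw.act_right h i x y σ
      have h2 := hw'.act_right h i x y σ
      simp only [WVCollection.wp_add, WVCollection.vs_add, map_add]
      rw [add_add_add_comm, h1, h2, add_add_add_comm]
    · intro m n k h i x y φ
      have h1 := hw.act_left h i x y φ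
      have h2 := hw'.act_left h i x y φ
      simp only [WVCollection.wp_add, WVCollection.vs_add, map_add, LinearMap.add_apply]
      rw [add_add_add_comm, h1, h2, add_add_add_comm]
    · intro m x σ τ
      have h1 := hw.act_mul x σ τ
      have h2 := hw'.act_mul x σ τ
      simp only [WVCollection.vs_add, map_add]
      rw [h1, h2, add_add_add_comm]
  smul_mem' c w hw := by
    constructor
    · intro l m n p q r hp hr hq hr' i j a ha x y z
      have h1 := hw.assoc hp hr hq hr' i j a ha x y z
      simp only [WVCollection.wp_smul, map_smul, LinearMap.smul_apply]
      rw [← smul_add, h1, smul_add]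
    · intro l m n p q r hp hr hq hr' i k hik a ha b hb x y z
      have h1 := hw.comm hp hr hq hr' i k hik a ha b hb x y z
      simp only [WVCollection.wp_smul, map_smul, LinearMap.smul_apply]
      rw [← smul_add, h1, smul_add]
    · intro m n k h i x y σ
      have h1 := hw.act_right h i x y σ
      simp only [WVCollection.wp_smul, WVCollection.vs_smul, map_smul]
      rw [← smul_add, h1, smul_add]
    · intro m n k h i x y φ
      have h1 := hw.act_left h i x y φ
      simp only [WVCollection.wp_smul, WVCollection.vs_smul, map_smul, LinearMap.smul_apply]
      rw [← smul_add, h1, smul_add]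
    · intro m x σ τ
      have h1 := hw.act_mul x σ τ
      simp only [WVCollection.vs_smul, map_smul]
      rw [h1, smul_add]

/-- The `℘ς`-collections with `ς = 0`. -/
noncomputable def symmetricCollections (R : Type u) [CommRing R] (M : ℕ → Type v) [∀ n, AddCommGroup (M n)]
    [∀ n, Module R (M n)] : Submodule R (WVCollection R M) where
  carrier := {w | ∀ (m : ℕ) (σ : Equiv.Perm (Fin m)) (x : M m), w.vs σ x = 0}
  zero_mem' _ _ _ := rfl
  add_mem' {w w'} hw hw' m σ x := by
    rw [WVCollection.vs_add, hw m σ x, hw' m σ x, add_zero]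
  smul_mem' c w hw m σ x := by
    rw [WVCollection.vs_smul, hw m σ x, smul_zero]

/-- The module `Z²(P)` of `S`-2-cocycles, that is, 2-cocycles with `ς = 0`. -/
noncomputable def OperadStructure.Z2 (O : OperadStructure R M) : Submodule R (WVCollection R M) :=
  O.Z2Star ⊓ symmetricCollections R M

/-- The `℘ς`-collection of an arity-preserving linear map `∂ : P → P`:
`℘_i(x, y) = ∂(x ∘_i y) - (∂x ∘_i y + x ∘_i ∂y)` and `ς(x, σ) = ∂(x * σ) - ∂x * σ`. -/
noncomputable def OperadStructure.coboundary (O : OperadStructure R M) (d : ∀ n, M n →ₗ[R] M n) :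
    WVCollection R M :=
  (fun c => (O.comp c.arity c.i).compr₂ (d c.k) -
      ((O.comp c.arity c.i).comp (d c.m) + (O.comp c.arity c.i).compl₂ (d c.n)),
    fun m σ => (d m).comp (O.act σ) - (O.act σ).comp (d m))

theorem OperadStructure.coboundary_wp (O : OperadStructure R M) (d : ∀ n, M n →ₗ[R] M n)
    {m n k : ℕ} (h : m + n = k + 1) (i : Fin m) (x : M m) (y : M n) :
    (O.coboundary d).wp h i x y =
      d k (O.comp h i x y) - (O.comp h i (d m x) y + O.comp h i x (d n y)) := rfl

theorem OperadStructure.coboundary_vs (O : OperadStructure R M) (d : ∀ n, M n →ₗ[R] M n)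
    {m : ℕ} (σ : Equiv.Perm (Fin m)) (x : M m) :
    (O.coboundary d).vs σ x = d m (O.act σ x) - O.act σ (d m x) := rfl

theorem WVCollection.ext {w w' : WVCollection R M}
    (h1 : ∀ {m n k : ℕ} (h : m + n = k + 1) (i : Fin m) (x : M m) (y : M n),
      w.wp h i x y = w'.wp h i x y)
    (h2 : ∀ {m : ℕ} (σ : Equiv.Perm (Fin m)) (x : M m), w.vs σ x = w'.vs σ x) : w = w' := by
  refine Prod.ext ?_ ?_
  · funext c
    exact LinearMap.ext fun x => LinearMap.ext fun y => h1 c.arity c.i x y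
  · funext m σ
    exact LinearMap.ext fun x => h2 σ x

/-- The module `B²_*(P)` of 2-coboundaries. -/
noncomputable def OperadStructure.B2Star (O : OperadStructure R M) : Submodule R (WVCollection R M) where
  carrier := {w | ∃ d : ∀ n, M n →ₗ[R] M n, w = O.coboundary d}
  zero_mem' := by
    refine ⟨fun _ => 0, WVCollection.ext ?_ ?_⟩
    · intro m n k h i x y
      simp [O.coboundary_wp, WVCollection.wp_zero]
    · intro m σ x
      simp [O.coboundary_vs, WVCollection.vs_zero]
  add_mem' := by
    rintro _ _ ⟨d, rfl⟩ ⟨d', rfl⟩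
    refine ⟨fun n => d n + d' n, WVCollection.ext ?_ ?_⟩
    · intro m n k h i x y
      simp only [WVCollection.wp_add, O.coboundary_wp, LinearMap.add_apply, map_add]
      abel
    · intro m σ x
      simp only [WVCollection.vs_add, O.coboundary_vs, LinearMap.add_apply, map_add]
      abel
  smul_mem' := by
    rintro c _ ⟨d, rfl⟩
    refine ⟨fun n => c • d n, WVCollection.ext ?_ ?_⟩
    · intro m n k h i x y
      simp only [WVCollection.wp_smul, O.coboundary_wp, LinearMap.smul_apply, map_smul, smul_sub,
        smul_add]
    · intro m σ x
      simp only [WVCollection.vs_smul, O.coboundary_vs, LinearMap.smul_apply, map_smul, smul_sub]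

/-- The module `B²(P)` of `S`-2-coboundaries, that is, 2-coboundaries with `ς = 0`. -/
noncomputable def OperadStructure.B2 (O : OperadStructure R M) : Submodule R (WVCollection R M) :=
  O.B2Star ⊓ symmetricCollections R M

/-- Every 2-coboundary is a 2-cocycle. -/
theorem OperadStructure.B2Star_le_Z2Star (O : OperadStructure R M) : O.B2Star ≤ O.Z2Star := by
  rintro _ ⟨d, rfl⟩
  constructor
  · intro l m n p q r hp hr hq hr' i j a ha x y z
    simp only [O.coboundary_wp, map_add, map_sub, LinearMap.add_apply, LinearMap.sub_apply,
      O.comp_assoc hp hr hq hr' i j a ha]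
    abel
  · intro l m n p q r hp hr hq hr' i k hik a ha b hb x y z
    simp only [O.coboundary_wp, map_add, map_sub, LinearMap.add_apply, LinearMap.sub_apply,
      O.comp_comm hp hr hq hr' i k hik a ha b hb]
    abel
  · intro m n k h i x y σ
    simp only [O.coboundary_wp, O.coboundary_vs, map_add, map_sub, O.comp_act_right]
    abel
  · intro m n k h i x y φ
    simp only [O.coboundary_wp, O.coboundary_vs, map_add, map_sub, LinearMap.sub_apply,
      O.comp_act_left]
    abel
  · intro m x σ τ
    simp only [O.coboundary_vs, map_sub, O.act_mul]
    abel

/-- The second cohomology `H²_*(P) = Z²_*(P) / B²_*(P)`. -/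
abbrev OperadStructure.H2Star (O : OperadStructure R M) : Type v :=
  O.Z2Star ⧸ O.B2Star.submoduleOf O.Z2Star

/-- The second `S`-cohomology `H²(P) = Z²(P) / B²(P)`. -/
abbrev OperadStructure.H2 (O : OperadStructure R M) : Type v :=
  O.Z2 ⧸ O.B2.submoduleOf O.Z2

/-! ## Infinitesimal deformations -/

/-- An infinitesimal deformation of an operad `P` over `R`: an `R[ε]`-linear operad structure on
`P[ε] = R[ε] ⊗ P`, `ε² = 0`, with the same identity, such that
`x ∘_i^ε y = x ∘_i y + ℘_i(x, y) ε` and `x *^ε σ = x * σ + ς(x, σ) ε` for all `x`, `y` in `P`. -/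
structure InfinitesimalDeformation (O : OperadStructure R M) where
  toOperad : OperadStructure (DualNumber R) (fun n => DualNumber R ⊗[R] M n)
  collection : WVCollection R M
  one_eq : toOperad.one = 1 ⊗ₜ[R] O.one
  comp_eq : ∀ {m n k : ℕ} (h : m + n = k + 1) (i : Fin m) (x : M m) (y : M n),
    toOperad.comp h i (1 ⊗ₜ[R] x) (1 ⊗ₜ[R] y) =
      1 ⊗ₜ[R] O.comp h i x y + DualNumber.eps ⊗ₜ[R] collection.wp h i x y
  act_eq : ∀ {m : ℕ} (σ : Equiv.Perm (Fin m)) (x : M m),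
    toOperad.act σ (1 ⊗ₜ[R] x) = 1 ⊗ₜ[R] O.act σ x + DualNumber.eps ⊗ₜ[R] collection.vs σ x

/-- Two infinitesimal deformations are equivalent if there is an `R[ε]`-linear isomorphism of
operads `Φ` from the first to the second of the form `Φ(x) = x + ∂(x) ε`, `x ∈ P`, for an
(arity-preserving) `R`-linear map `∂ : P → P`. -/
def InfinitesimalDeformation.Equivalent {O : OperadStructure R M}
    (D D' : InfinitesimalDeformation O) : Prop :=
  ∃ Φ : ∀ n, (DualNumber R ⊗[R] M n) ≃ₗ[DualNumber R] (DualNumber R ⊗[R] M n),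
    Φ 1 D.toOperad.one = D'.toOperad.one ∧
    (∀ {n : ℕ} (σ : Equiv.Perm (Fin n)) (x : DualNumber R ⊗[R] M n),
      Φ n (D.toOperad.act σ x) = D'.toOperad.act σ (Φ n x)) ∧
    (∀ {m n k : ℕ} (h : m + n = k + 1) (i : Fin m) (x : DualNumber R ⊗[R] M m)
      (y : DualNumber R ⊗[R] M n),
      Φ k (D.toOperad.comp h i x y) = D'.toOperad.comp h i (Φ m x) (Φ n y)) ∧
    ∃ d : ∀ n, M n →ₗ[R] M n, ∀ (n : ℕ) (x : M n),
      Φ n (1 ⊗ₜ[R] x) = 1 ⊗ₜ[R] x + DualNumber.eps ⊗ₜ[R] d n x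

/-- An infinitesimal deformation is trivial if it is equivalent to the one defined by the zero
`℘ς`-collection. -/
def InfinitesimalDeformation.IsTrivial {O : OperadStructure R M}
    (D : InfinitesimalDeformation O) : Prop :=
  ∃ D₀ : InfinitesimalDeformation O, D₀.collection = 0 ∧ D.Equivalent D₀

end Cohomology

/-! A 2-cocycle `w` on an operad `O` is the same as a twist of the square-zero extension `O ⊕ O ε`,
and `w` is a coboundary once the projection of that twisted operad `E` onto `O` has an operadic
section `x ↦ (x, ∂x)` (`mem_B2Star_of_section`). So the task is to split `E → P` for `P = As/ᵏI`.

Since `P` is a quotient of `As`, and `As` is generated by a unit and a product subject only to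
associativity and the unit laws, a section arises in two moves: lift the unit and the product of `P`
to an associative unital pair in `E`, which gives an operad map `As → E` (`fromAs_comp`), and check
that this map kills `ᵏI` (`fromAs_lift_eq_zero`).

Lifting. `P(1)` is spanned by the identity, so a multiple of `μ ε` repairs the left unit law, and
the right unit law follows by filling both slots of the product with the unit
(`exists_unital_lift`). The associator of the lift is then `f ε` with `f` in `P(3)`. For `k ≤ 3`,
filling any slot of `f` with the unit gives `0`, and in arity at least `k` this forces `f = 0`: that
is what the truncation ideal is for (`asTrunc_eq_zero_of_comp_unit`). For `k ≥ 5`, nothing is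
divided out in arities up to `4`, so the pentagon identity is a linear system for `f` in the group
module of `S_3`. Its solutions are the multiples of the Hochschild differential of the commutator
`xy - yx` (`eq_smul_of_asPentagon_eq_zero`), so a multiple of the commutator corrects the product.
The commutator dies when a slot is filled with the unit, so the unit laws survive. No division
occurs, hence the characteristic is irrelevant. For `k = 4` neither argument is available: arity `3`
lies below the truncation, while the pentagon holds only modulo `⁴I(4)`.

Descent. Induction on the arity with the same detection principle: on `ᵏI` the map `As → E` takes
values in the `ε`-part, and filling a slot with the unit lowers the arity inside the ideal.

Finally, the `ε`-coefficients of the operad axioms of a deformation are the cocycle conditions, and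
a cochain `∂` bounding the cocycle gives the trivializing isomorphism `x ↦ x - ∂(x) ε`. -/

section General

variable {R : Type u} [CommRing R] {M : ℕ → Type v} [∀ n, AddCommGroup (M n)]
  [∀ n, Module R (M n)]

/-! ## Operads under `As` -/

/-- A binary operation `μ` that is associative with two-sided unit `u`. -/
structure OperadStructure.IsAssocUnital (O : OperadStructure R M) (u : M 0) (μ : M 2) : Prop where
  assoc : O.comp (m := 2) (n := 2) (k := 3) rfl 0 μ μ = O.comp (m := 2) (n := 2) (k := 3) rfl 1 μ μ
  left_unit : O.comp (m := 2) (n := 0) (k := 1) rfl 0 μ u = O.one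
  right_unit : O.comp (m := 2) (n := 0) (k := 1) rfl 1 μ u = O.one

/-- The iterated product of `n` inputs. -/
def OperadStructure.iterProd (O : OperadStructure R M) (u : M 0) (μ : M 2) : ∀ n, M n
  | 0 => u
  | n + 1 => O.comp (m := 2) (n := n) (k := n + 1) (by omega) 0 μ (O.iterProd u μ n)

namespace OperadStructure.IsAssocUnital

variable {O : OperadStructure R M} {u : M 0} {μ : M 2}

/-- The product of an `a`-fold and a `b`-fold product is the `(a + b)`-fold one. Since iterated
products are bracketed to the left, the induction peels the last factor off the right operand. -/
theorem mul_iterProd (H : O.IsAssocUnital u μ) (a b p k : ℕ) (hb : 2 + b = p + 1)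
    (h : p + a = k + 1) (i : Fin p) (hi : (i : ℕ) = 0) :
    O.comp h i (O.comp hb 1 μ (O.iterProd u μ b)) (O.iterProd u μ a) = O.iterProd u μ k := by
  induction b generalizing p k with
  | zero =>
    obtain rfl : p = 1 := by omega
    obtain rfl : i = 0 := Subsingleton.elim _ _
    obtain rfl : k = a := by omega
    have : O.comp hb 1 μ (O.iterProd u μ 0) = O.one := H.right_unit
    rw [this, O.one_comp]
  | succ b ih =>
    obtain rfl : p = b + 2 := by omega
    obtain rfl : k = a + b + 1 := by omega
    -- The law `x(yz) = (xy)z`, with the `b`-fold product in place of `y`.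
    have h1 : O.comp hb 1 μ (O.iterProd u μ (b + 1)) =
        O.comp (m := 2) (n := b + 1) (k := b + 2) (by omega) 0 μ
          (O.comp (m := 2) (n := b) (k := b + 1) (by omega) 1 μ (O.iterProd u μ b)) := by
      change O.comp _ 1 μ (O.comp _ 0 μ (O.iterProd u μ b)) = _
      rw [← O.comp_assoc (l := 2) (m := 2) (n := b) (p := 3) (q := b + 1) (r := b + 2) rfl
          (by omega) (by omega) hb 1 0 1 rfl,
        ← O.comp_assoc (l := 2) (m := 2) (n := b) (p := 3) (q := b + 1) (r := b + 2) rfl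
          (by omega) (by omega) hb 0 1 1 rfl, H.assoc]
    rw [h1, O.comp_assoc (l := 2) (m := b + 1) (n := a) (p := b + 2) (q := a + b) (r := a + b + 1)
        hb h (by omega) (by omega) 0 0 i (by simpa using hi),
      ih (b + 1) (a + b) _ _ _ rfl]
    rfl

theorem iterProd_comp (H : O.IsAssocUnital u μ) (m n k : ℕ) (h : m + n = k + 1) (i : Fin m) :
    O.comp h i (O.iterProd u μ m) (O.iterProd u μ n) = O.iterProd u μ k := by
  induction m generalizing k with
  | zero => exact i.elim0
  | succ m ih =>
    obtain rfl : k = m + n := by omega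
    change O.comp _ i (O.comp _ 0 μ (O.iterProd u μ m)) _ = _
    -- The slots below `m` belong to the nested `m`-fold product, so induction applies. The last
    -- slot is the second input of the outer `μ`; there the two insertions commute and
    -- `mul_iterProd` finishes.
    rcases Nat.lt_or_ge i m with hi | hi
    · obtain ⟨q, hq⟩ : ∃ q, m + n = q + 1 := ⟨m + n - 1, by omega⟩
      rw [O.comp_assoc (q := q) (j := ⟨i, hi⟩) _ _ hq (by omega) 0 (a := i) (by simp), ih _ hq]
      -- The recursion unfolds only at an arity of the literal form `q + 1`, whereas the target
      -- arity is `m + n`.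
      have : ∀ k, ∀ hk : k = q + 1, ∀ h : 2 + q = k + 1,
          O.comp h 0 μ (O.iterProd u μ q) = O.iterProd u μ k := by
        rintro k rfl h
        rfl
      exact this _ hq _
    · have hi' := i.isLt
      rw [O.comp_comm (q := n + 1) _ _ (by omega) (by omega) (0 : Fin 2) (1 : Fin 2) (by decide) i
        (by simp; omega) 0 rfl]
      exact H.mul_iterProd _ _ _ _ _ _ _ rfl

end OperadStructure.IsAssocUnital

/-- The map `As → O`, `σ ↦ μ_n * σ`, where `μ_n` is the `n`-fold product. -/
noncomputable def OperadStructure.fromAs (O : OperadStructure R M) (u : M 0) (μ : M 2) (n : ℕ) :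
    (Equiv.Perm (Fin n) →₀ R) →ₗ[R] M n :=
  Finsupp.linearCombination R (fun σ => O.act σ (O.iterProd u μ n))

theorem OperadStructure.fromAs_single (O : OperadStructure R M) (u : M 0) (μ : M 2) {n : ℕ}
    (σ : Equiv.Perm (Fin n)) (c : R) :
    O.fromAs u μ n (Finsupp.single σ c) = c • O.act σ (O.iterProd u μ n) := by
  simp [OperadStructure.fromAs]

theorem OperadStructure.fromAs_act (O : OperadStructure R M) (u : M 0) (μ : M 2) {n : ℕ}
    (σ : Equiv.Perm (Fin n)) (x : Equiv.Perm (Fin n) →₀ R) :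
    O.fromAs u μ n (asAct R σ x) = O.act σ (O.fromAs u μ n x) := by
  induction x using Finsupp.induction_linear with
  | zero => simp
  | add x y hx hy => rw [map_add, map_add, hx, hy, map_add, map_add]
  | single τ c => rw [asAct_single, O.fromAs_single, O.fromAs_single, O.act_mul, map_smul]

/-- Equivariance moves the permutations outside, where they combine as in `permComp_mul`; what
remains is that iterated products are closed under partial composition, which is `iterProd_comp`. -/
theorem OperadStructure.IsAssocUnital.fromAs_comp {O : OperadStructure R M} {u : M 0} {μ : M 2}
    (H : O.IsAssocUnital u μ) {m n k : ℕ} (h : m + n = k + 1) (i : Fin m)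
    (x : Equiv.Perm (Fin m) →₀ R) (y : Equiv.Perm (Fin n) →₀ R) :
    O.fromAs u μ k (asComp R h i x y) = O.comp h i (O.fromAs u μ m x) (O.fromAs u μ n y) := by
  induction x using Finsupp.induction_linear with
  | zero => simp
  | add x x' hx hx' => simp only [map_add, LinearMap.add_apply, hx, hx']
  | single σ c =>
    induction y using Finsupp.induction_linear with
    | zero => simp
    | add y y' hy hy' => simp only [map_add, hy, hy']
    | single τ d =>
      have := permComp_mul h i 1 σ τ 1
      simp only [one_mul, mul_one] at this
      simp only [asComp_single, O.fromAs_single, map_smul, LinearMap.smul_apply, smul_smul,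
        O.comp_act_left, O.comp_act_right, H.iterProd_comp, this, O.act_mul]
      rw [mul_comm]

/-! ## Identities for a binary operation -/

/-- The associator of a binary operation. -/
def OperadStructure.associator (O : OperadStructure R M) (μ : M 2) : M 3 :=
  O.comp (m := 2) (n := 2) (k := 3) rfl 0 μ μ - O.comp (m := 2) (n := 2) (k := 3) rfl 1 μ μ

/-- Once a slot is filled with the unit, both bracketings collapse to `μ` by the unit laws alone.
This disposes of the associator when `k ≤ 3`. -/
theorem OperadStructure.associator_comp_unit (O : OperadStructure R M) {u : M 0} {μ : M 2}
    (hl : O.comp (m := 2) (n := 0) (k := 1) rfl 0 μ u = O.one)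
    (hr : O.comp (m := 2) (n := 0) (k := 1) rfl 1 μ u = O.one) (j : Fin 3) :
    O.comp (m := 3) (n := 0) (k := 2) rfl j (O.associator μ) u = 0 := by
  rw [OperadStructure.associator, map_sub, LinearMap.sub_apply, sub_eq_zero]
  have h3 : ∀ j : Fin 3, j = 0 ∨ j = 1 ∨ j = 2 := by decide
  rcases h3 j with rfl | rfl | rfl
  · rw [O.comp_assoc (m := 2) (p := 3) (q := 1) (r := 2) rfl rfl rfl rfl 0 0 0 rfl, hl, O.comp_one]
    have := O.comp_comm (l := 2) (m := 0) (n := 2) (p := 1) (q := 3) (r := 2) rfl rfl rfl rfl 0 1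
      (by decide) 0 rfl 0 rfl μ u μ
    rw [hl, O.one_comp] at this
    exact this
  · rw [O.comp_assoc (m := 2) (p := 3) (q := 1) (r := 2) rfl rfl rfl rfl 0 1 1 rfl,
      O.comp_assoc (m := 2) (p := 3) (q := 1) (r := 2) rfl rfl rfl rfl 1 0 1 rfl, hl, hr,
      O.comp_one, O.comp_one]
  · rw [O.comp_assoc (m := 2) (p := 3) (q := 1) (r := 2) rfl rfl rfl rfl 1 1 2 rfl, hr, O.comp_one,
      O.comp_comm (l := 2) (m := 2) (p := 3) (q := 1) (r := 2) rfl rfl rfl rfl 0 1 (by decide) 2 rfl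
        0 rfl, hr, O.one_comp]

/-- The pentagon identity for the associator. -/
theorem OperadStructure.associator_pentagon (O : OperadStructure R M) (μ : M 2) :
    O.comp (m := 2) (n := 3) (k := 4) rfl 1 μ (O.associator μ)
      - O.comp (m := 3) (n := 2) (k := 4) rfl 0 (O.associator μ) μ
      + O.comp (m := 3) (n := 2) (k := 4) rfl 1 (O.associator μ) μ
      - O.comp (m := 3) (n := 2) (k := 4) rfl 2 (O.associator μ) μ
      + O.comp (m := 2) (n := 3) (k := 4) rfl 0 μ (O.associator μ) = 0 := by
  -- The ten terms are the five bracketings of four inputs, each occurring twice with opposite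
  -- signs; associativity of `μ` plays no role.
  simp only [OperadStructure.associator, map_sub, LinearMap.sub_apply]
  rw [O.comp_assoc (l := 2) (m := 2) (p := 3) (q := 3) (r := 4) rfl rfl rfl rfl 0 0 0 rfl,
    O.comp_assoc (l := 2) (m := 2) (p := 3) (q := 3) (r := 4) rfl rfl rfl rfl 0 1 1 rfl,
    O.comp_assoc (l := 2) (m := 2) (p := 3) (q := 3) (r := 4) rfl rfl rfl rfl 1 0 1 rfl,
    O.comp_assoc (l := 2) (m := 2) (p := 3) (q := 3) (r := 4) rfl rfl rfl rfl 1 1 2 rfl,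
    O.comp_comm (l := 2) (m := 2) (p := 3) (q := 3) (r := 4) rfl rfl rfl rfl 0 1 (by decide) 2 rfl
      0 rfl]
  abel

/-! ## The square-zero extension of an operad by a 2-cocycle -/

/-- The operad of pairs `x + x' ε` attached to a 2-cocycle. -/
noncomputable def OperadStructure.squareZero (O : OperadStructure R M) {w : WVCollection R M}
    (hw : O.IsTwoCocycle w) : OperadStructure R (fun n => M n × M n) where
  -- The correction is forced: the cocycle condition at `(x, 1, 1)` gives `℘(x, 1) = x ∘ ℘(1, 1)`,
  -- so the term `-℘(1, 1)` is what cancels `℘(x, 1)`.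
  one := (O.one, -w.wp (m := 1) (n := 1) (k := 1) rfl 0 O.one O.one)
  act σ := LinearMap.prod ((O.act σ).comp (LinearMap.fst R _ _))
    ((O.act σ).comp (LinearMap.snd R _ _) + (w.vs σ).comp (LinearMap.fst R _ _))
  comp h i := LinearMap.mk₂ R
    (fun x y => (O.comp h i x.1 y.1, O.comp h i x.2 y.1 + O.comp h i x.1 y.2 + w.wp h i x.1 y.1))
    (fun x x' y => by
      ext
      · simp
      · simp only [Prod.fst_add, Prod.snd_add, map_add, LinearMap.add_apply]
        abel)
    (fun c x y => by ext <;> simp)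
    (fun x y y' => by
      ext
      · simp
      · simp only [Prod.fst_add, Prod.snd_add, map_add]
        abel)
    (fun c x y => by ext <;> simp)
  act_one x := by
    -- At `σ = τ = 1` the condition reads `ς(x, 1) = ς(x, 1) + ς(x, 1)`, so `ς(x, 1) = 0`.
    have h := hw.act_mul x.1 1 1
    rw [O.act_one, O.act_one, mul_one, left_eq_add] at h
    ext <;> simp [O.act_one, h]
  act_mul σ τ x := by
    ext
    · simp [O.act_mul]
    · simp only [LinearMap.prod_apply, Function.prod_apply, LinearMap.add_apply, LinearMap.comp_apply,
        LinearMap.fst_apply, LinearMap.snd_apply, O.act_mul, hw.act_mul, map_add]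
      abel
  comp_one {m} h i x := by
    have e := hw.assoc (l := m) (m := 1) (n := 1) rfl rfl rfl rfl i 0 i (by simp) x.1 O.one O.one
    simp only [O.comp_one, add_right_inj] at e
    ext
    · simp [O.comp_one]
    · simp only [LinearMap.mk₂_apply, O.comp_one, map_neg]
      rw [e]
      abel
  one_comp {n} h x := by
    have e := hw.assoc (l := 1) (m := 1) (n := n) rfl h h h 0 0 0 rfl O.one O.one x.1
    simp only [O.one_comp] at e
    rw [add_comm, add_left_inj] at e
    ext
    · simp [O.one_comp]
    · simp only [LinearMap.mk₂_apply, O.one_comp, map_neg, LinearMap.neg_apply]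
      rw [e]
      abel
  comp_assoc hp hr hq hr' i j a ha x y z := by
    have e := hw.assoc hp hr hq hr' i j a ha x.1 y.1 z.1
    ext
    · simp [O.comp_assoc hp hr hq hr' i j a ha]
    · simp only [LinearMap.mk₂_apply, map_add, LinearMap.add_apply,
        O.comp_assoc hp hr hq hr' i j a ha] at e ⊢
      linear_combination (norm := abel) e
  comp_comm hp hr hq hr' i k hik a ha b hb x y z := by
    have e := hw.comm hp hr hq hr' i k hik a ha b hb x.1 y.1 z.1
    ext
    · simp [O.comp_comm hp hr hq hr' i k hik a ha b hb]
    · simp only [LinearMap.mk₂_apply, map_add, LinearMap.add_apply,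
        O.comp_comm hp hr hq hr' i k hik a ha b hb] at e ⊢
      linear_combination (norm := abel) e
  comp_act_right h i x y σ := by
    have e := hw.act_right h i x.1 y.1 σ
    ext
    · simp [O.comp_act_right]
    · simp only [LinearMap.mk₂_apply, LinearMap.prod_apply, Function.prod_apply, LinearMap.add_apply,
        LinearMap.comp_apply, LinearMap.fst_apply, LinearMap.snd_apply, map_add,
        O.comp_act_right] at e ⊢
      linear_combination (norm := abel) e
  comp_act_left h i x y φ := by
    have e := hw.act_left h i x.1 y.1 φ
    ext
    · simp [O.comp_act_left]
    · simp only [LinearMap.mk₂_apply, LinearMap.prod_apply, Function.prod_apply, LinearMap.add_apply,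
        LinearMap.comp_apply, LinearMap.fst_apply, LinearMap.snd_apply, map_add,
        O.comp_act_left] at e ⊢
      linear_combination (norm := abel) e

end General

/-! ## Coefficients of partial compositions in `As` -/

/-- `permComp` is built from the inverse of a bijection obtained noncomputably. This closed formula
makes equations between concrete permutations accessible to `decide`, through `permComp_eq_iff`. -/
theorem permComp_val {m n k : ℕ} (h : m + n = k + 1) (i : Fin m)
    (σ : Equiv.Perm (Fin m)) (τ : Equiv.Perm (Fin n)) (c : Fin k) :
    (permComp h i σ τ c : ℕ) =
      if h1 : i ≤ (c : ℕ) ∧ (c : ℕ) < i + n then (σ i : ℕ) + τ ⟨c - i, by omega⟩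
      else
        let b : Fin m := ⟨if (c : ℕ) < i then c else c + 1 - n, by split_ifs <;> omega⟩
        if (σ b : ℕ) < σ i then (σ b : ℕ) else σ b + n - 1 := by
  by_cases h1 : i ≤ (c : ℕ) ∧ (c : ℕ) < i + n
  · rw [dif_pos h1]
    exact permComp_val_inner h i σ τ ⟨c - i, by omega⟩ c (by simp; omega)
  · rw [dif_neg h1]
    have hc := c.isLt
    have hi := i.isLt
    refine permComp_val_outer h i σ τ _ (fun e => ?_) c ?_
    · have := congrArg Fin.val e
      by_cases hci : (c : ℕ) < i <;> simp only [hci, if_true, if_false] at this <;> omega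
    · by_cases hci : (c : ℕ) < i
      · simp [hci]
      · simp only [hci, if_false]
        rw [if_neg (by omega)]
        omega

theorem permComp_eq_iff {m n k : ℕ} (h : m + n = k + 1) (i : Fin m)
    (σ : Equiv.Perm (Fin m)) (τ : Equiv.Perm (Fin n)) (ρ : Equiv.Perm (Fin k)) :
    permComp h i σ τ = ρ ↔ ∀ c : Fin k,
      (if h1 : i ≤ (c : ℕ) ∧ (c : ℕ) < i + n then (σ i : ℕ) + τ ⟨c - i, by omega⟩
      else
        let b : Fin m := ⟨if (c : ℕ) < i then c else c + 1 - n, by split_ifs <;> omega⟩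
        if (σ b : ℕ) < σ i then (σ b : ℕ) else σ b + n - 1) = ρ c := by
  rw [Equiv.ext_iff]
  exact forall_congr' fun c => by rw [← permComp_val, Fin.ext_iff]

theorem permComp_one_one {m n k : ℕ} (h : m + n = k + 1) (i : Fin m) :
    permComp h i 1 1 = 1 := by
  have h1 := permComp_mul h i 1 1 1 1
  rw [one_mul, one_mul, Equiv.Perm.one_apply] at h1
  exact left_eq_mul.1 h1

theorem asComp_single_right_apply (R : Type u) [CommRing R] {m n k : ℕ} (h : m + n = k + 1)
    (i : Fin m) (x : Equiv.Perm (Fin m) →₀ R) (τ : Equiv.Perm (Fin n)) (ρ : Equiv.Perm (Fin k)) :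
    asComp R h i x (Finsupp.single τ 1) ρ =
      ∑ σ ∈ Finset.univ.filter (fun σ => permComp h i σ τ = ρ), x σ := by
  induction x using Finsupp.induction_linear with
  | zero => simp
  | add x y hx hy =>
    simp only [map_add, LinearMap.add_apply, Finsupp.add_apply, hx, hy, Finset.sum_add_distrib]
  | single σ c =>
    rw [asComp_single, Finset.sum_filter, Finset.sum_eq_single σ]
    · simp [Finsupp.single_apply]
    · intro b _ hb
      simp [hb.symm]
    · simp

theorem asComp_single_left_apply (R : Type u) [CommRing R] {m n k : ℕ} (h : m + n = k + 1)
    (i : Fin m) (σ : Equiv.Perm (Fin m)) (y : Equiv.Perm (Fin n) →₀ R) (ρ : Equiv.Perm (Fin k)) :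
    asComp R h i (Finsupp.single σ 1) y ρ =
      ∑ τ ∈ Finset.univ.filter (fun τ => permComp h i σ τ = ρ), y τ := by
  induction y using Finsupp.induction_linear with
  | zero => simp
  | add x y hx hy =>
    simp only [map_add, Finsupp.add_apply, hx, hy, Finset.sum_add_distrib]
  | single τ c =>
    rw [asComp_single, Finset.sum_filter, Finset.sum_eq_single τ]
    · simp [Finsupp.single_apply]
    · intro b _ hb
      simp [hb.symm]
    · simp

/-- The differential of a ternary operation `f` of `As`, with the product `x y`. -/
noncomputable def asPentagon (R : Type u) [CommRing R] (f : Equiv.Perm (Fin 3) →₀ R) :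
    Equiv.Perm (Fin 4) →₀ R :=
  asComp R (m := 2) (n := 3) (k := 4) rfl 1 (Finsupp.single 1 1) f
    - asComp R (m := 3) (n := 2) (k := 4) rfl 0 f (Finsupp.single 1 1)
    + asComp R (m := 3) (n := 2) (k := 4) rfl 1 f (Finsupp.single 1 1)
    - asComp R (m := 3) (n := 2) (k := 4) rfl 2 f (Finsupp.single 1 1)
    + asComp R (m := 2) (n := 3) (k := 4) rfl 0 (Finsupp.single 1 1) f

theorem asPentagon_apply (R : Type u) [CommRing R] (f : Equiv.Perm (Fin 3) →₀ R)
    (ρ : Equiv.Perm (Fin 4)) {s₁ s₂ s₃ s₄ s₅ : Finset (Equiv.Perm (Fin 3))}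
    (h₁ : ∀ σ, permComp (m := 2) (n := 3) (k := 4) rfl 1 1 σ = ρ ↔ σ ∈ s₁)
    (h₂ : ∀ σ, permComp (m := 3) (n := 2) (k := 4) rfl 0 σ 1 = ρ ↔ σ ∈ s₂)
    (h₃ : ∀ σ, permComp (m := 3) (n := 2) (k := 4) rfl 1 σ 1 = ρ ↔ σ ∈ s₃)
    (h₄ : ∀ σ, permComp (m := 3) (n := 2) (k := 4) rfl 2 σ 1 = ρ ↔ σ ∈ s₄)
    (h₅ : ∀ σ, permComp (m := 2) (n := 3) (k := 4) rfl 0 1 σ = ρ ↔ σ ∈ s₅) :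
    asPentagon R f ρ = ∑ σ ∈ s₁, f σ - ∑ σ ∈ s₂, f σ + ∑ σ ∈ s₃, f σ - ∑ σ ∈ s₄, f σ
      + ∑ σ ∈ s₅, f σ := by
  simp only [asPentagon, Finsupp.add_apply, Finsupp.sub_apply, asComp_single_left_apply,
    asComp_single_right_apply, h₁, h₂, h₃, h₄, h₅, Finset.filter_univ_mem]

/-! ### Solving the pentagon equation in arity three -/

theorem perm_fin_three_cases (σ : Equiv.Perm (Fin 3)) :
    σ = 1 ∨ σ = Equiv.swap 1 2 ∨ σ = Equiv.swap 0 1 ∨ σ = finRotate 3 ∨ σ = (finRotate 3)⁻¹ ∨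
      σ = Equiv.swap 0 2 := by
  revert σ
  decide

/-- The Hochschild differential of the commutator. -/
theorem asComp_commutator (R : Type u) [CommRing R] (b : Equiv.Perm (Fin 2) →₀ R)
    (hb : b = Finsupp.single 1 1 - Finsupp.single (Equiv.swap 0 1) 1) :
    asComp R (m := 2) (n := 2) (k := 3) rfl 0 b (Finsupp.single 1 1)
      + asComp R (m := 2) (n := 2) (k := 3) rfl 0 (Finsupp.single 1 1) b
      - asComp R (m := 2) (n := 2) (k := 3) rfl 1 b (Finsupp.single 1 1)
      - asComp R (m := 2) (n := 2) (k := 3) rfl 1 (Finsupp.single 1 1) b =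
    Finsupp.single (Equiv.swap 1 2) 1 - Finsupp.single (Equiv.swap 0 1) 1
      - Finsupp.single (finRotate 3) 1 + Finsupp.single (finRotate 3)⁻¹ 1 := by
  have h1 : permComp (m := 2) (n := 2) (k := 3) rfl 0 (Equiv.swap 0 1) 1 = finRotate 3 := by
    rw [permComp_eq_iff]
    decide
  have h2 : permComp (m := 2) (n := 2) (k := 3) rfl 0 1 (Equiv.swap 0 1) = Equiv.swap 0 1 := by
    rw [permComp_eq_iff]
    decide
  have h3 : permComp (m := 2) (n := 2) (k := 3) rfl 1 (Equiv.swap 0 1) 1 = (finRotate 3)⁻¹ := by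
    rw [permComp_eq_iff]
    decide
  have h4 : permComp (m := 2) (n := 2) (k := 3) rfl 1 1 (Equiv.swap 0 1) = Equiv.swap 1 2 := by
    rw [permComp_eq_iff]
    decide
  simp only [hb, map_sub, LinearMap.sub_apply, asComp_single, permComp_one_one, h1, h2, h3, h4,
    mul_one]
  abel

theorem eq_smul_of_asPentagon_eq_zero (R : Type u) [CommRing R] (f : Equiv.Perm (Fin 3) →₀ R)
    (hf : asPentagon R f = 0) :
    f = f (Equiv.swap 1 2) • (Finsupp.single (Equiv.swap 1 2) 1 - Finsupp.single (Equiv.swap 0 1) 1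
      - Finsupp.single (finRotate 3) 1 + Finsupp.single (finRotate 3)⁻¹ 1) := by
  -- Five of the 24 coefficients suffice: `e1` and `e2` kill the coefficients of `f` at the identity
  -- and at the reversal, and `e3`, `e4`, `e5` express the other three through the one at `swap 1
  -- 2`.
  have e1 := asPentagon_apply R f 1 (s₁ := {1}) (s₂ := {1}) (s₃ := {1}) (s₄ := {1}) (s₅ := {1})
    (by simp only [permComp_eq_iff]; decide) (by simp only [permComp_eq_iff]; decide)
    (by simp only [permComp_eq_iff]; decide) (by simp only [permComp_eq_iff]; decide)
    (by simp only [permComp_eq_iff]; decide)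
  have e2 := asPentagon_apply R f (Equiv.swap 1 3) (s₁ := {Equiv.swap 0 2}) (s₂ := ∅) (s₃ := ∅)
    (s₄ := ∅) (s₅ := ∅)
    (by simp only [permComp_eq_iff]; decide) (by simp only [permComp_eq_iff]; decide)
    (by simp only [permComp_eq_iff]; decide) (by simp only [permComp_eq_iff]; decide)
    (by simp only [permComp_eq_iff]; decide)
  have e3 := asPentagon_apply R f (Equiv.swap 1 2) (s₁ := {Equiv.swap 0 1}) (s₂ := ∅) (s₃ := ∅)
    (s₄ := ∅) (s₅ := {Equiv.swap 1 2})
    (by simp only [permComp_eq_iff]; decide) (by simp only [permComp_eq_iff]; decide)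
    (by simp only [permComp_eq_iff]; decide) (by simp only [permComp_eq_iff]; decide)
    (by simp only [permComp_eq_iff]; decide)
  have e4 := asPentagon_apply R f (Equiv.swap 1 2 * Equiv.swap 2 3) (s₁ := {finRotate 3})
    (s₂ := ∅) (s₃ := {Equiv.swap 1 2}) (s₄ := ∅) (s₅ := ∅)
    (by simp only [permComp_eq_iff]; decide) (by simp only [permComp_eq_iff]; decide)
    (by simp only [permComp_eq_iff]; decide) (by simp only [permComp_eq_iff]; decide)
    (by simp only [permComp_eq_iff]; decide)
  have e5 := asPentagon_apply R f (Equiv.swap 2 3 * Equiv.swap 1 2) (s₁ := {(finRotate 3)⁻¹})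
    (s₂ := ∅) (s₃ := ∅) (s₄ := {Equiv.swap 1 2}) (s₅ := ∅)
    (by simp only [permComp_eq_iff]; decide) (by simp only [permComp_eq_iff]; decide)
    (by simp only [permComp_eq_iff]; decide) (by simp only [permComp_eq_iff]; decide)
    (by simp only [permComp_eq_iff]; decide)
  simp only [hf, Finsupp.coe_zero, Pi.zero_apply, Finset.sum_singleton, Finset.sum_empty]
    at e1 e2 e3 e4 e5
  ext σ
  simp only [Finsupp.smul_apply, Finsupp.add_apply, Finsupp.sub_apply, Finsupp.single_apply,
    smul_eq_mul]
  rcases perm_fin_three_cases σ with rfl | rfl | rfl | rfl | rfl | rfl <;>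
    simp (decide := true) only [if_true, if_false]
  · linear_combination -e1
  · ring
  · linear_combination -e3
  · linear_combination -e4
  · linear_combination -e5
  · linear_combination -e2

section General

variable {R : Type u} [CommRing R] {M : ℕ → Type v} [∀ n, AddCommGroup (M n)]
  [∀ n, Module R (M n)] {O : OperadStructure R M} {w : WVCollection R M}

/-! ## Lifting the product of `As` to a square-zero extension -/

theorem OperadStructure.squareZero_comp (hw : O.IsTwoCocycle w) {m n k : ℕ} (h : m + n = k + 1)
    (i : Fin m) (x : M m × M m) (y : M n × M n) :
    (O.squareZero hw).comp h i x y = (O.comp h i x.1 y.1,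
      O.comp h i x.2 y.1 + O.comp h i x.1 y.2 + w.wp h i x.1 y.1) := rfl

theorem OperadStructure.squareZero_act (hw : O.IsTwoCocycle w) {n : ℕ} (σ : Equiv.Perm (Fin n))
    (x : M n × M n) :
    (O.squareZero hw).act σ x = (O.act σ x.1, O.act σ x.2 + w.vs σ x.1) := rfl

/-- The kernel of the projection to `O` is a copy of `O` on which the extension acts through `O`:
the twist `℘` vanishes when an argument has zero constant term. -/
theorem OperadStructure.squareZero_comp_eps_left (hw : O.IsTwoCocycle w) {m n k : ℕ}
    (h : m + n = k + 1) (i : Fin m) (x : M m) (y : M n × M n) :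
    (O.squareZero hw).comp h i (0, x) y = (0, O.comp h i x y.1) := by
  simp [OperadStructure.squareZero_comp]

theorem OperadStructure.squareZero_comp_eps_right (hw : O.IsTwoCocycle w) {m n k : ℕ}
    (h : m + n = k + 1) (i : Fin m) (x : M m × M m) (y : M n) :
    (O.squareZero hw).comp h i x (0, y) = (0, O.comp h i x.1 y) := by
  simp [OperadStructure.squareZero_comp]

/-- A unital product lifts to a unital product of the extension. -/
theorem OperadStructure.IsAssocUnital.exists_unital_lift {u : M 0} {μ : M 2}
    (H : O.IsAssocUnital u μ) (hw : O.IsTwoCocycle w) (h1 : ∀ z : M 1, ∃ c : R, z = c • O.one)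
    (hu : ∀ c : R, c • u = 0 → c = 0) :
    ∃ m : M 2,
      (O.squareZero hw).comp (m := 2) (n := 0) (k := 1) rfl 0 (μ, m) (u, 0) =
        (O.squareZero hw).one ∧
      (O.squareZero hw).comp (m := 2) (n := 0) (k := 1) rfl 1 (μ, m) (u, 0) =
        (O.squareZero hw).one := by
  set Q := O.squareZero hw with hQ
  have lift_eq (x : M 1 × M 1) (hx : x.1 = O.one) : ∃ c : R, x = Q.one + (0, c • O.one) := by
    obtain ⟨c, hc⟩ := h1 (x.2 - Q.one.2)
    refine ⟨c, Prod.ext ?_ ?_⟩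
    · rw [hx, Prod.fst_add, add_zero]
      rfl
    · rw [Prod.snd_add, ← hc, add_sub_cancel]
  -- Here `c` is the left unit defect of the lift `(μ, 0)`. Adding `-c • μ` in the `ε`-part cancels
  -- it, because `μ` filled with `u` is the identity.
  obtain ⟨c, hc⟩ := lift_eq (Q.comp (m := 2) (n := 0) (k := 1) rfl 0 (μ, 0) (u, 0)) H.left_unit
  obtain ⟨d, hd⟩ := lift_eq (Q.comp (m := 2) (n := 0) (k := 1) rfl 1 (μ, -c • μ) (u, 0))
    H.right_unit
  have hl : Q.comp (m := 2) (n := 0) (k := 1) rfl 0 (μ, -c • μ) (u, 0) = Q.one := by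
    have : ((μ, -c • μ) : M 2 × M 2) = (μ, 0) + (0, -c • μ) := by simp
    rw [this, map_add, LinearMap.add_apply, hc, hQ, O.squareZero_comp_eps_left, map_smul,
      LinearMap.smul_apply, H.left_unit, add_assoc]
    simp
  refine ⟨-c • μ, hl, ?_⟩
  -- Filling both slots of the lift with the unit gives the same element in either order, so the
  -- right defect satisfies `d • u = 0`.
  have e := Q.comp_comm (l := 2) (m := 0) (n := 0) (p := 1) (q := 1) (r := 0) rfl rfl rfl rfl 0 1
    (by decide) 0 rfl 0 rfl (μ, -c • μ) (u, 0) (u, 0)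
  rw [hl, hd, map_add, LinearMap.add_apply, left_eq_add, hQ, O.squareZero_comp_eps_left, map_smul,
    LinearMap.smul_apply, O.one_comp] at e
  have hd0 : d = 0 := hu d (congrArg Prod.snd e)
  rw [hd, hd0, zero_smul]
  exact add_zero _

theorem OperadStructure.IsAssocUnital.associator_lift {u : M 0} {μ : M 2}
    (H : O.IsAssocUnital u μ) (hw : O.IsTwoCocycle w) (m : M 2) :
    (O.squareZero hw).associator (μ, m) = (0, ((O.squareZero hw).associator (μ, m)).2) := by
  refine Prod.ext ?_ rfl
  exact sub_eq_zero.2 H.assoc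

theorem OperadStructure.associator_lift_add (hw : O.IsTwoCocycle w) (μ m b : M 2) :
    (O.squareZero hw).associator (μ, m + b) = (O.squareZero hw).associator (μ, m) +
      (0, O.comp (m := 2) (n := 2) (k := 3) rfl 0 b μ + O.comp (m := 2) (n := 2) (k := 3) rfl 0 μ b
        - O.comp (m := 2) (n := 2) (k := 3) rfl 1 b μ
        - O.comp (m := 2) (n := 2) (k := 3) rfl 1 μ b) := by
  -- There is no term quadratic in `b`, since `ε² = 0`; the change of the associator is the
  -- Hochschild differential of `b`.
  have : ((μ, m + b) : M 2 × M 2) = (μ, m) + (0, b) := by simp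
  simp only [this, OperadStructure.associator, map_add, LinearMap.add_apply,
    O.squareZero_comp_eps_left, O.squareZero_comp_eps_right, map_zero]
  ext
  · simp
  · simp only [Prod.snd_add, Prod.snd_sub]
    abel

/-- An operadic section of the extension exhibits the cocycle as a coboundary. -/
theorem OperadStructure.mem_B2Star_of_section (hw : O.IsTwoCocycle w) (d : ∀ n, M n →ₗ[R] M n)
    (hcomp : ∀ {m n k : ℕ} (h : m + n = k + 1) (i : Fin m) (x : M m) (y : M n),
      (O.squareZero hw).comp h i (x, d m x) (y, d n y) =
        (O.comp h i x y, d k (O.comp h i x y)))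
    (hact : ∀ {n : ℕ} (σ : Equiv.Perm (Fin n)) (x : M n),
      (O.squareZero hw).act σ (x, d n x) = (O.act σ x, d n (O.act σ x))) :
    w ∈ O.B2Star := by
  refine ⟨d, WVCollection.ext ?_ ?_⟩
  · intro m n k h i x y
    have := congrArg Prod.snd (hcomp h i x y)
    simp only [O.squareZero_comp] at this
    rw [O.coboundary_wp, ← this]
    abel
  · intro m σ x
    have := congrArg Prod.snd (hact σ x)
    simp only [O.squareZero_act] at this
    rw [O.coboundary_vs, ← this]
    abel

end General

/-! ## The truncations of `As` -/

section AsTrunc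

variable {R : Type u} [CommRing R] {k : ℕ}

theorem asTrunc_comp_mk {m n r : ℕ} (h : m + n = r + 1) (i : Fin m) (x : Equiv.Perm (Fin m) →₀ R)
    (y : Equiv.Perm (Fin n) →₀ R) :
    (asTrunc R k).comp h i (Submodule.Quotient.mk x) (Submodule.Quotient.mk y) =
      Submodule.Quotient.mk (asComp R h i x y) := rfl

theorem asTrunc_act_mk {n : ℕ} (σ : Equiv.Perm (Fin n)) (x : Equiv.Perm (Fin n) →₀ R) :
    (asTrunc R k).act σ (Submodule.Quotient.mk x) = Submodule.Quotient.mk (asAct R σ x) := rfl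

/-- The unit of `As/ᵏI` in arity `0`. -/
noncomputable def asTruncUnit (R : Type u) [CommRing R] (k : ℕ) : AsTruncModule R k 0 :=
  Submodule.Quotient.mk (asUnit R)

/-- The product of `As/ᵏI`. -/
noncomputable def asTruncMul (R : Type u) [CommRing R] (k : ℕ) : AsTruncModule R k 2 :=
  Submodule.Quotient.mk (Finsupp.single 1 1)

theorem asTrunc_isAssocUnital : (asTrunc R k).IsAssocUnital (asTruncUnit R k) (asTruncMul R k) := by
  have hmul {m n r : ℕ} (h : m + n = r + 1) (i : Fin m) :
      (asTrunc R k).comp h i (Submodule.Quotient.mk (Finsupp.single 1 1))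
        (Submodule.Quotient.mk (Finsupp.single 1 1)) =
          Submodule.Quotient.mk (Finsupp.single 1 1) := by
    rw [asTrunc_comp_mk, asComp_single, permComp_one_one, mul_one]
  exact ⟨(hmul (m := 2) (n := 2) (r := 3) rfl 0).trans (hmul (m := 2) (n := 2) (r := 3) rfl 1).symm,
    hmul (m := 2) (n := 0) (r := 1) rfl 0, hmul (m := 2) (n := 0) (r := 1) rfl 1⟩

/-- The truncation ideal in arity `n + 1 ≥ k` consists of the elements whose unit fillings all lie
in the ideal, so the quotient is detected by those fillings. Both the associator for `k ≤ 3` and the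
descent to the quotient rest on this. -/
theorem asTrunc_eq_zero_of_comp_unit (hk : 1 ≤ k) {n : ℕ} (hn : k ≤ n + 1)
    (z : AsTruncModule R k (n + 1))
    (hz : ∀ j : Fin (n + 1),
      (asTrunc R k).comp (m := n + 1) (n := 0) (k := n) rfl j z (asTruncUnit R k) = 0) :
    z = 0 := by
  obtain ⟨x, rfl⟩ := Submodule.Quotient.mk_surjective _ z
  rw [Submodule.Quotient.mk_eq_zero, (asOperad R).mem_truncIdeal_succ _ hk hn]
  intro j
  exact (Submodule.Quotient.mk_eq_zero _).1 (hz j)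

theorem asTrunc_mk_eq_zero {n : ℕ} (hn : n < k) (x : Equiv.Perm (Fin n) →₀ R)
    (hx : (Submodule.Quotient.mk x : AsTruncModule R k n) = 0) : x = 0 :=
  ((asOperad R).mem_truncIdeal_of_lt _ hn x).1 ((Submodule.Quotient.mk_eq_zero _).1 hx)

theorem asTrunc_exists_smul_one (z : AsTruncModule R k 1) : ∃ c : R, z = c • (asTrunc R k).one := by
  obtain ⟨x, rfl⟩ := Submodule.Quotient.mk_surjective _ z
  refine ⟨x 1, ?_⟩
  change Submodule.Quotient.mk x = x 1 • Submodule.Quotient.mk (Finsupp.single 1 1)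
  rw [← Submodule.Quotient.mk_smul]
  refine congrArg _ (Finsupp.ext fun σ => ?_)
  obtain rfl : σ = 1 := Subsingleton.elim _ _
  simp

theorem asTrunc_smul_unit_eq_zero (hk : 1 ≤ k) (c : R) (hc : c • asTruncUnit R k = 0) : c = 0 := by
  have := asTrunc_mk_eq_zero (k := k) (by omega) (c • asUnit R) hc
  simpa [asUnit] using this

variable {w : WVCollection R (AsTruncModule R k)}

/-- The obstruction is the associator of a unital lift: it vanishes outright for `k ≤ 3`, and is
removed by a multiple of the commutator for `k ≥ 5`. -/
theorem asTrunc_exists_isAssocUnital_lift (hk : 1 ≤ k) (hk4 : k ≠ 4)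
    (hw : (asTrunc R k).IsTwoCocycle w) :
    ∃ m, ((asTrunc R k).squareZero hw).IsAssocUnital (asTruncUnit R k, 0) (asTruncMul R k, m) := by
  have H := asTrunc_isAssocUnital (R := R) (k := k)
  obtain ⟨m, hl, hr⟩ := H.exists_unital_lift hw asTrunc_exists_smul_one
    (asTrunc_smul_unit_eq_zero hk)
  have hA := H.associator_lift hw m
  rcases Nat.lt_or_ge 3 k with h | h
  · have hpent := congrArg Prod.snd (((asTrunc R k).squareZero hw).associator_pentagon
      (asTruncMul R k, m))
    obtain ⟨f, hf⟩ := Submodule.Quotient.mk_surjective _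
      (((asTrunc R k).squareZero hw).associator (asTruncMul R k, m)).2
    rw [hA, ← hf] at hpent
    simp only [OperadStructure.squareZero_comp_eps_left,
      OperadStructure.squareZero_comp_eps_right] at hpent
    -- The exclusion of `k = 4` enters here: `4 < k` makes the quotient map injective in arity `4`,
    -- so the pentagon holds in `As` itself.
    have hf0 : asPentagon R f = 0 := asTrunc_mk_eq_zero (k := k) (by omega) _ hpent
    have hfc := eq_smul_of_asPentagon_eq_zero R f hf0
    rw [← asComp_commutator R _ rfl] at hfc
    set c := f (Equiv.swap 1 2)
    let b : Equiv.Perm (Fin 2) →₀ R :=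
      -c • (Finsupp.single 1 1 - Finsupp.single (Equiv.swap 0 1) 1)
    -- The two permutations of two letters restrict to the same element of the trivial group `S_1`,
    -- so their difference vanishes.
    have hbu (j : Fin 2) : asComp R (m := 2) (n := 0) (k := 1) rfl j b (asUnit R) = 0 := by
      have e : permComp (m := 2) (n := 0) (k := 1) rfl j 1 1 =
        permComp (m := 2) (n := 0) (k := 1) rfl j (Equiv.swap 0 1) 1 := Subsingleton.elim _ _
      simp only [b, asUnit, map_smul, map_sub, LinearMap.smul_apply, LinearMap.sub_apply,
        asComp_single, e, sub_self, smul_zero]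
    have hunit (j : Fin 2) :
        ((asTrunc R k).squareZero hw).comp (m := 2) (n := 0) (k := 1) rfl j
          (asTruncMul R k, m + Submodule.Quotient.mk b) (asTruncUnit R k, 0) =
        ((asTrunc R k).squareZero hw).comp (m := 2) (n := 0) (k := 1) rfl j
          (asTruncMul R k, m) (asTruncUnit R k, 0) := by
      have : ((asTruncMul R k, m + Submodule.Quotient.mk b) : AsTruncModule R k 2 × _) =
        (asTruncMul R k, m) + (0, Submodule.Quotient.mk b) := by simp
      rw [this, map_add, LinearMap.add_apply, OperadStructure.squareZero_comp_eps_left]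
      change _ + (0, (asTrunc R k).comp _ j _ (Submodule.Quotient.mk (asUnit R))) = _
      rw [asTrunc_comp_mk, hbu]
      exact add_zero _
    refine ⟨m + Submodule.Quotient.mk b, ?_, (hunit 0).trans hl, (hunit 1).trans hr⟩
    refine sub_eq_zero.1 ?_
    change ((asTrunc R k).squareZero hw).associator _ = 0
    rw [OperadStructure.associator_lift_add, hA, ← hf]
    refine Prod.ext (add_zero _) ?_
    change Submodule.Quotient.mk (f + (asComp R _ 0 b (Finsupp.single 1 1)
      + asComp R _ 0 (Finsupp.single 1 1) b - asComp R _ 1 b (Finsupp.single 1 1)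
      - asComp R _ 1 (Finsupp.single 1 1) b)) = 0
    refine (congrArg _ ?_).trans (Submodule.Quotient.mk_zero _)
    rw [hfc]
    simp only [b, map_smul, LinearMap.smul_apply]
    module
  · refine ⟨m, sub_eq_zero.1 (hA.trans (Prod.ext rfl ?_)), hl, hr⟩
    refine asTrunc_eq_zero_of_comp_unit hk (by omega) _ fun j => ?_
    have := OperadStructure.associator_comp_unit _ hl hr j
    rw [hA, OperadStructure.squareZero_comp_eps_left] at this
    exact congrArg Prod.snd this

/-! ### Splitting the square-zero extension -/

theorem fst_fromAs_lift (hw : (asTrunc R k).IsTwoCocycle w) (m : AsTruncModule R k 2) {n : ℕ}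
    (x : Equiv.Perm (Fin n) →₀ R) :
    (((asTrunc R k).squareZero hw).fromAs (asTruncUnit R k, 0) (asTruncMul R k, m) n x).1 =
      Submodule.Quotient.mk x := by
  have hprod : ∀ n, (((asTrunc R k).squareZero hw).iterProd (asTruncUnit R k, 0)
      (asTruncMul R k, m) n).1 = Submodule.Quotient.mk (Finsupp.single 1 1) := by
    intro n
    induction n with
    | zero => rfl
    | succ n ih =>
      rw [OperadStructure.iterProd, OperadStructure.squareZero_comp]
      simp only [ih]
      rw [asTruncMul, asTrunc_comp_mk, asComp_single, permComp_one_one, mul_one]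
  induction x using Finsupp.induction_linear with
  | zero => simp
  | add x y hx hy => rw [map_add, Prod.fst_add, hx, hy, Submodule.Quotient.mk_add]
  | single σ c =>
    rw [OperadStructure.fromAs_single, OperadStructure.squareZero_act, Prod.smul_fst]
    simp only [hprod]
    rw [asTrunc_act_mk, asAct_single, one_mul, ← Submodule.Quotient.mk_smul, Finsupp.smul_single,
      smul_eq_mul, mul_one]

/-- Induction on the arity. On the ideal the lifted map has zero first component; filling a slot of
the second with the unit gives the image of an element of the ideal one arity lower, which is `0`,
so the second component vanishes too. -/
theorem fromAs_lift_eq_zero (hk : 1 ≤ k) (hw : (asTrunc R k).IsTwoCocycle w)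
    {m : AsTruncModule R k 2}
    (H : ((asTrunc R k).squareZero hw).IsAssocUnital (asTruncUnit R k, 0) (asTruncMul R k, m))
    (n : ℕ) (x : Equiv.Perm (Fin n) →₀ R) (hx : x ∈ (asOperad R).truncIdeal (asUnit R) k n) :
    ((asTrunc R k).squareZero hw).fromAs (asTruncUnit R k, 0) (asTruncMul R k, m) n x = 0 := by
  induction n with
  | zero => rw [((asOperad R).mem_truncIdeal_of_lt _ (by omega) x).1 hx, map_zero]
  | succ n ih =>
    rcases Nat.lt_or_ge (n + 1) k with h | h
    · rw [((asOperad R).mem_truncIdeal_of_lt _ h x).1 hx, map_zero]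
    · set y := ((asTrunc R k).squareZero hw).fromAs (asTruncUnit R k, 0) (asTruncMul R k, m)
        (n + 1) x with hy
      have hy1 : y.1 = 0 := (fst_fromAs_lift hw m x).trans ((Submodule.Quotient.mk_eq_zero _).2 hx)
      refine Prod.ext hy1 (asTrunc_eq_zero_of_comp_unit hk h _ fun j => ?_)
      have e := ih (asComp R (m := n + 1) (n := 0) (k := n) rfl j x (asUnit R))
        ((asOperad R).comp_unit_mem_truncIdeal _ rfl j x hx)
      have hu : ((asTrunc R k).squareZero hw).fromAs (asTruncUnit R k, 0) (asTruncMul R k, m) 0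
          (asUnit R) = (asTruncUnit R k, 0) := by
        refine (OperadStructure.fromAs_single _ _ _ 1 1).trans ?_
        rw [one_smul, OperadStructure.act_one]
        rfl
      rw [H.fromAs_comp, ← hy, hu, show y = (0, y.2) from Prod.ext hy1 rfl,
        OperadStructure.squareZero_comp_eps_left] at e
      exact congrArg Prod.snd e

theorem asTrunc_mem_B2Star (hk : 1 ≤ k) (hk4 : k ≠ 4) (hw : (asTrunc R k).IsTwoCocycle w) :
    w ∈ (asTrunc R k).B2Star := by
  obtain ⟨m, H⟩ := asTrunc_exists_isAssocUnital_lift hk hk4 hw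
  let φ := ((asTrunc R k).squareZero hw).fromAs (asTruncUnit R k, 0) (asTruncMul R k, m)
  -- The `ε`-component of the operad map `As → E`, descended to the quotient; paired with the
  -- identity it is the required section.
  let d : ∀ n, AsTruncModule R k n →ₗ[R] AsTruncModule R k n := fun n =>
    Submodule.liftQ _ ((LinearMap.snd R _ _).comp (φ n)) fun x hx => by
      rw [LinearMap.mem_ker, LinearMap.comp_apply, fromAs_lift_eq_zero hk hw H n x hx, map_zero]
  have hd (n : ℕ) (x : Equiv.Perm (Fin n) →₀ R) :
      ((Submodule.Quotient.mk x, d n (Submodule.Quotient.mk x)) :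
        AsTruncModule R k n × AsTruncModule R k n) = φ n x :=
    Prod.ext (fst_fromAs_lift hw m x).symm rfl
  refine OperadStructure.mem_B2Star_of_section hw d ?_ ?_
  · intro m' n r h i x y
    obtain ⟨x, rfl⟩ := Submodule.Quotient.mk_surjective _ x
    obtain ⟨y, rfl⟩ := Submodule.Quotient.mk_surjective _ y
    rw [hd, hd, asTrunc_comp_mk, hd]
    exact (H.fromAs_comp h i x y).symm
  · intro n σ x
    obtain ⟨x, rfl⟩ := Submodule.Quotient.mk_surjective _ x
    rw [hd, asTrunc_act_mk, hd]
    exact (OperadStructure.fromAs_act _ _ _ σ x).symm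

end AsTrunc

section Deformation

variable {R : Type u} [CommRing R] {M : ℕ → Type v} [∀ n, AddCommGroup (M n)]
  [∀ n, Module R (M n)] {O : OperadStructure R M}

/-! ## Infinitesimal deformations and cocycles -/

/-- The coefficient of `ε`. -/
noncomputable def epsCoeff (R : Type u) [CommRing R] (N : Type v) [AddCommGroup N] [Module R N] :
    DualNumber R ⊗[R] N →ₗ[R] N :=
  (TensorProduct.lid R N).toLinearMap ∘ₗ (TrivSqZeroExt.sndHom R R).rTensor N

theorem epsCoeff_add (N : Type v) [AddCommGroup N] [Module R N] (x y : N) :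
    epsCoeff R N (1 ⊗ₜ x + DualNumber.eps ⊗ₜ y) = y := by
  simp [epsCoeff]

theorem eps_smul_add (N : Type v) [AddCommGroup N] [Module R N] (x y : N) :
    (DualNumber.eps : DualNumber R) • ((1 : DualNumber R) ⊗ₜ[R] x + DualNumber.eps ⊗ₜ[R] y) =
      DualNumber.eps ⊗ₜ[R] x := by
  rw [smul_add, TensorProduct.smul_tmul', TensorProduct.smul_tmul', smul_eq_mul, smul_eq_mul,
    mul_one, DualNumber.eps_mul_eps, TensorProduct.zero_tmul, add_zero]

theorem eps_tmul_eq (N : Type v) [AddCommGroup N] [Module R N] (x : N) :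
    (DualNumber.eps : DualNumber R) ⊗ₜ[R] x =
      (DualNumber.eps : DualNumber R) • ((1 : DualNumber R) ⊗ₜ[R] x) := by
  rw [TensorProduct.smul_tmul', smul_eq_mul, mul_one]

namespace InfinitesimalDeformation

variable (D : InfinitesimalDeformation O)

theorem comp_add {m n k : ℕ} (h : m + n = k + 1) (i : Fin m) (x x' : M m) (y y' : M n) :
    D.toOperad.comp h i (1 ⊗ₜ[R] x + DualNumber.eps ⊗ₜ[R] x')
        (1 ⊗ₜ[R] y + DualNumber.eps ⊗ₜ[R] y') =
      1 ⊗ₜ[R] O.comp h i x y + DualNumber.eps ⊗ₜ[R]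
        (D.collection.wp h i x y + O.comp h i x' y + O.comp h i x y') := by
  rw [eps_tmul_eq _ x', eps_tmul_eq _ y']
  simp only [map_add, LinearMap.add_apply, map_smul, LinearMap.smul_apply, D.comp_eq, smul_add]
  simp only [TensorProduct.tmul_add, TensorProduct.smul_tmul', smul_eq_mul, mul_one,
    DualNumber.eps_mul_eps, TensorProduct.zero_tmul, add_zero]
  abel

theorem comp_left {m n k : ℕ} (h : m + n = k + 1) (i : Fin m) (x x' : M m) (y : M n) :
    D.toOperad.comp h i (1 ⊗ₜ[R] x + DualNumber.eps ⊗ₜ[R] x') (1 ⊗ₜ[R] y) =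
      1 ⊗ₜ[R] O.comp h i x y +
        DualNumber.eps ⊗ₜ[R] (D.collection.wp h i x y + O.comp h i x' y) := by
  simpa using D.comp_add h i x x' y 0

theorem comp_right {m n k : ℕ} (h : m + n = k + 1) (i : Fin m) (x : M m) (y y' : M n) :
    D.toOperad.comp h i (1 ⊗ₜ[R] x) (1 ⊗ₜ[R] y + DualNumber.eps ⊗ₜ[R] y') =
      1 ⊗ₜ[R] O.comp h i x y +
        DualNumber.eps ⊗ₜ[R] (D.collection.wp h i x y + O.comp h i x y') := by
  simpa using D.comp_add h i x 0 y y'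

theorem act_add {n : ℕ} (σ : Equiv.Perm (Fin n)) (x x' : M n) :
    D.toOperad.act σ (1 ⊗ₜ[R] x + DualNumber.eps ⊗ₜ[R] x') =
      1 ⊗ₜ[R] O.act σ x + DualNumber.eps ⊗ₜ[R] (D.collection.vs σ x + O.act σ x') := by
  rw [map_add, D.act_eq, eps_tmul_eq _ x', map_smul,
    D.act_eq, eps_smul_add, TensorProduct.tmul_add, add_assoc]

/-- Each condition is the coefficient of `ε` in the matching operad axiom of the deformation,
evaluated on elements without `ε`-part. -/
theorem isTwoCocycle : O.IsTwoCocycle D.collection where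
  assoc hp hr hq hr' i j a ha x y z := by
    have e := congrArg (epsCoeff R _)
      (D.toOperad.comp_assoc hp hr hq hr' i j a ha (1 ⊗ₜ x) (1 ⊗ₜ y) (1 ⊗ₜ z))
    rwa [D.comp_eq, D.comp_eq, D.comp_left, D.comp_right, epsCoeff_add, epsCoeff_add] at e
  comm hp hr hq hr' i k hik a ha b hb x y z := by
    have e := congrArg (epsCoeff R _)
      (D.toOperad.comp_comm hp hr hq hr' i k hik a ha b hb (1 ⊗ₜ x) (1 ⊗ₜ y) (1 ⊗ₜ z))
    rwa [D.comp_eq, D.comp_eq, D.comp_left, D.comp_left, epsCoeff_add, epsCoeff_add] at e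
  act_right h i x y σ := by
    have e := congrArg (epsCoeff R _) (D.toOperad.comp_act_right h i (1 ⊗ₜ x) (1 ⊗ₜ y) σ)
    rw [D.act_eq, D.comp_eq, D.comp_right, D.act_add, epsCoeff_add, epsCoeff_add] at e
    rw [e, add_comm]
  act_left h i x y φ := by
    have e := congrArg (epsCoeff R _) (D.toOperad.comp_act_left h i (1 ⊗ₜ x) (1 ⊗ₜ y) φ)
    rw [D.act_eq, D.comp_eq, D.comp_left, D.act_add, epsCoeff_add, epsCoeff_add] at e
    rw [e, add_comm]
  act_mul x σ τ := by
    have e := congrArg (epsCoeff R _) (D.toOperad.act_mul σ τ (1 ⊗ₜ x))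
    rwa [D.act_eq, D.act_eq, D.act_add, epsCoeff_add, epsCoeff_add] at e

end InfinitesimalDeformation

/-- The automorphism `x ↦ x + ∂(x) ε` of `N[ε]`. -/
noncomputable def epsAut {N : Type v} [AddCommGroup N] [Module R N] (d : N →ₗ[R] N) :
    (DualNumber R ⊗[R] N) ≃ₗ[DualNumber R] (DualNumber R ⊗[R] N) :=
  -- As `ε² = 0`, the maps `1 + ε d` and `1 + ε d'` compose to `1 + ε (d + d')`.
  have key (d d' : N →ₗ[R] N) (h : d + d' = 0) :
      (LinearMap.id + (DualNumber.eps : DualNumber R) • d.baseChange (DualNumber R)) ∘ₗ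
      (LinearMap.id + (DualNumber.eps : DualNumber R) • d'.baseChange (DualNumber R)) =
        LinearMap.id := by
    ext x
    have hx : d' x + d x = 0 := by rw [add_comm]; exact LinearMap.congr_fun h x
    simp [TensorProduct.smul_tmul', add_assoc, ← TensorProduct.tmul_add, hx]
  LinearEquiv.ofLinearMap
    (LinearMap.id + (DualNumber.eps : DualNumber R) • d.baseChange (DualNumber R))
    (LinearMap.id + (DualNumber.eps : DualNumber R) • (-d).baseChange (DualNumber R))
    (key _ _ (by simp)) (key _ _ (by simp))

theorem epsAut_add {N : Type v} [AddCommGroup N] [Module R N] (d : N →ₗ[R] N) (x y : N) :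
    epsAut d (1 ⊗ₜ[R] x + DualNumber.eps ⊗ₜ[R] y) =
      1 ⊗ₜ[R] x + DualNumber.eps ⊗ₜ[R] (y + d x) := by
  simp only [epsAut, LinearEquiv.coe_ofLinearMap, LinearMap.add_apply, LinearMap.id_apply, map_add,
    LinearMap.smul_apply, LinearMap.baseChange_tmul, TensorProduct.smul_tmul', smul_eq_mul, mul_one,
    DualNumber.eps_mul_eps, TensorProduct.zero_tmul, add_zero, TensorProduct.tmul_add]
  abel

theorem epsAut_tmul {N : Type v} [AddCommGroup N] [Module R N] (d : N →ₗ[R] N) (x : N) :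
    epsAut d (1 ⊗ₜ[R] x) = 1 ⊗ₜ[R] x + DualNumber.eps ⊗ₜ[R] d x := by
  simpa using epsAut_add d x 0

/-- Transport of an operad structure along linear equivalences. -/
def OperadStructure.transport {S : Type u} [CommRing S] {N N' : ℕ → Type v}
    [∀ n, AddCommGroup (N n)] [∀ n, Module S (N n)] [∀ n, AddCommGroup (N' n)]
    [∀ n, Module S (N' n)] (Q : OperadStructure S N) (Φ : ∀ n, N n ≃ₗ[S] N' n) :
    OperadStructure S N' where
  one := Φ 1 Q.one
  act {n} σ := (Φ n).toLinearMap ∘ₗ Q.act σ ∘ₗ (Φ n).symm.toLinearMap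
  comp {m n k} h i := ((Q.comp h i).compl₁₂ (Φ m).symm.toLinearMap (Φ n).symm.toLinearMap).compr₂
    (Φ k).toLinearMap
  act_one x := by simp [Q.act_one]
  act_mul σ τ x := by simp [Q.act_mul]
  comp_one h i x := by simp [Q.comp_one]
  one_comp h x := by simp [Q.one_comp]
  comp_assoc hp hr hq hr' i j a ha x y z := by
    simp [Q.comp_assoc hp hr hq hr' i j a ha]
  comp_comm hp hr hq hr' i k hik a ha b hb x y z := by
    simp [Q.comp_comm hp hr hq hr' i k hik a ha b hb]
  comp_act_right h i x y σ := by simp [Q.comp_act_right]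
  comp_act_left h i x y φ := by simp [Q.comp_act_left]

theorem InfinitesimalDeformation.isTrivial_of_mem_B2Star (D : InfinitesimalDeformation O)
    (hD : D.collection ∈ O.B2Star) : D.IsTrivial := by
  obtain ⟨d, hd⟩ := hD
  -- A deformation keeps the identity `1`, so `1 ∘ 1 = 1` forces `℘(1, 1) = 0`, while the coboundary
  -- of `d` at `(1, 1)` equals `-d(1)`. Without this the transported structure would have a
  -- different identity.
  have hone : d 1 O.one = 0 := by
    have e := D.toOperad.comp_one rfl 0 D.toOperad.one
    rw [D.one_eq, D.comp_eq, O.comp_one, add_eq_left] at e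
    have e' := congrArg (epsCoeff R _) e
    rw [← zero_add (DualNumber.eps ⊗ₜ[R] _), ← TensorProduct.tmul_zero (M 1) (1 : DualNumber R),
      epsCoeff_add, hd, O.coboundary_wp, O.comp_one, O.comp_one, O.one_comp] at e'
    simpa using e'
  -- The sign: the deformed product of `x + ∂(x) ε` and `y + ∂(y) ε` is `x ∘ y + ∂(x ∘ y) ε`, so `Φ`
  -- must send `x + ∂(x) ε` to `x`. Transport along `Φ` then supplies the undeformed structure, and
  -- `Φ` is an operad map by construction.
  let Φ : ∀ n, (DualNumber R ⊗[R] M n) ≃ₗ[DualNumber R] (DualNumber R ⊗[R] M n) :=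
    fun n => epsAut (-d n)
  have hsymm (n : ℕ) (x : M n) :
      (Φ n).symm (1 ⊗ₜ[R] x) = 1 ⊗ₜ[R] x + DualNumber.eps ⊗ₜ[R] d n x := by
    rw [LinearEquiv.symm_apply_eq, epsAut_add]
    simp
  refine ⟨⟨D.toOperad.transport Φ, 0, ?_, ?_, ?_⟩, rfl, Φ, rfl, ?_, ?_, fun n => -d n, ?_⟩
  · change Φ 1 D.toOperad.one = _
    rw [D.one_eq, epsAut_tmul]
    simp [hone]
  · intro m n k h i x y
    change Φ k (D.toOperad.comp h i ((Φ m).symm _) ((Φ n).symm _)) = _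
    rw [hsymm, hsymm, D.comp_add, epsAut_add, hd, O.coboundary_wp, WVCollection.wp_zero]
    congr 2
    rw [LinearMap.neg_apply]
    abel
  · intro m σ x
    change Φ m (D.toOperad.act σ ((Φ m).symm _)) = _
    rw [hsymm, D.act_add, epsAut_add, hd, O.coboundary_vs, WVCollection.vs_zero]
    congr 2
    rw [LinearMap.neg_apply]
    abel
  · intro n σ x
    change _ = Φ n (D.toOperad.act σ ((Φ n).symm (Φ n x)))
    rw [LinearEquiv.symm_apply_apply]
  · intro m n k h i x y
    change _ = Φ k (D.toOperad.comp h i ((Φ m).symm (Φ m x)) ((Φ n).symm (Φ n y)))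
    rw [LinearEquiv.symm_apply_apply, LinearEquiv.symm_apply_apply]
  · exact fun n x => epsAut_tmul _ x

end Deformation

/-! ### Vanishing of cohomology and rigidity -/

theorem theorem6p8 (𝕜 : Type u) [Field 𝕜] (k : ℕ) (hk : 1 ≤ k) (hk4 : k ≠ 4) :
    Subsingleton (asTrunc 𝕜 k).H2 ∧
    Subsingleton (asTrunc 𝕜 k).H2Star ∧
    ∀ D : InfinitesimalDeformation (asTrunc 𝕜 k), D.IsTrivial := by
  have key : (asTrunc 𝕜 k).Z2Star ≤ (asTrunc 𝕜 k).B2Star := fun w hw =>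
    asTrunc_mem_B2Star hk hk4 hw
  refine ⟨?_, ?_, fun D => D.isTrivial_of_mem_B2Star (key D.isTwoCocycle)⟩
  · rw [Submodule.Quotient.subsingleton_iff, Submodule.submoduleOf_eq_top]
    -- Both `Z2` and `B2` are cut out of their starred versions by `ς = 0`, so the inclusion
    -- restricts.
    exact inf_le_inf_right _ key
  · rw [Submodule.Quotient.subsingleton_iff, Submodule.submoduleOf_eq_top]
    exact key
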